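/- Let $\mathbb k$ be an algebraically closed field of characteristic $0$ and let $\mathcal C$ be a fusion category over $\mathbb k$ (a $\mathbb k$-linear, abelian, semisimple, rigid monoidal category with bilinear tensor product, finite-dimensional morphism spaces, finitely many isomorphism classes of simple objects and simple unit $1$). Let $(X_i)_{i\in I}$ be a set of representatives of the isomorphism classes of simple objects, with associator $a$, and write $H_{ij}^{\,k}=\mathrm{Hom}(X_i\otimes X_j,X_k)$ and $H^{ij}_{\,k}=\mathrm{Hom}(X_k,X_i\otimes X_j)$. Unit constraints are suppressed, and associators where they are evident. **Rigidity.** A rigidity $r$ consists of an involution $i\mapsto\bar i$ of $I$ and, for every $i$, morphisms $\cup_i:1\to X_{\bar i}\otimes X_i$ and $\cap'_i:X_i\otimes X_{\bar i}\to 1$ satisfying the two snake identities. Put $\cup'_i=\cup_{\bar i}:1\to X_i\otimes X_{\bar i}$ and $\cap_i=\cap'_{\bar i}:X_{\bar i}\otimes X_i\to 1$; thus $X_{\bar i}$ is a left dual of $X_i$ via $(\cup_i,\cap'_i)$ and a right dual via $(\cup'_i,\cap_i)$. The left and right dimensions of $X_i$ are the scalars $d_i=\cap'_i\circ\cup'_i$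 and $d_{\bar i}=\cap_i\circ\cup_i$. Fix square roots $\sqrt{d_id_{\bar i}}$ for $i\in I$, with the convention $\sqrt{d_id_{\bar i}}=d_i$ whenever $d_i=d_{\bar i}$. **Signs.** For $\alpha\in H_{ij}^{\,k}$ let $\alpha^\vee: X_{\bar k}\to X_{\bar j}\otimes X_{\bar i}$ be the right dual morphism and $\alpha^{\vee\vee}\in H_{ij}^{\,k}$ the right dual of $\alpha^\vee$, formed with the above cups and caps and, for tensor products, the nested ones. A scalar $\varepsilon_\alpha$ is called the sign of a non-zero $\alpha\in H_{ij}^{\,k}$ if $$\alpha^{\vee\vee}=\varepsilon_\alpha\,\frac{d_i}{\sqrt{d_id_{\bar i}}}\,\frac{d_j}{\sqrt{d_jd_{\bar j}}}\,\frac{d_{\bar k}}{\sqrt{d_kd_{\bar k}}}\;\alpha ,$$ that is, $\alpha^{\vee\vee}=\varepsilon_\alpha\,\alpha$ if left and right dimensions coincide. An eigenbasis of $H_{ij}^{\,k}$ is a basis consisting of elements with signs $\pm1$. **$6j$-symbols.** Choose bases of all $H_{ij}^{\,k}$, and let $\bar\alpha\in H^{ij}_{\,k}$ run through the dual basis, $\alpha'\circ\bar\alpha=\delta_{\alpha,\alpha'}\,\mathrm{id}$.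 The $6j$-symbols $F$ and their inverses $G$ are defined by $$\alpha\circ(\mathrm{id}_{X_i}\otimes\beta)\circ a=\sum_{q,\gamma,\delta}F^{(ijk)l}_{pq;\alpha\beta\gamma\delta}\;\delta\circ(\gamma\otimes\mathrm{id}_{X_k}),\qquad \delta\circ(\gamma\otimes\mathrm{id}_{X_k})\circ a^{-1}=\sum_{p,\alpha,\beta}G^{(ijk)l}_{qp;\gamma\delta\alpha\beta}\;\alpha\circ(\mathrm{id}_{X_i}\otimes\beta)$$ for $\alpha\in H_{ip}^{\,l}$, $\beta\in H_{jk}^{\,p}$, $\gamma\in H_{ij}^{\,q}$, $\delta\in H_{qk}^{\,l}$. Let $$\mathcal H^F_{ijk,pql}=H_{jk}^{\,p}\otimes H^{qk}_{\,l}\otimes H_{ip}^{\,l}\otimes H^{ij}_{\,q},\qquad \mathcal H^G_{ijk,pql}=H^{jk}_{\,p}\otimes H_{qk}^{\,l}\otimes H^{ip}_{\,l}\otimes H_{ij}^{\,q},\qquad \mathcal H^{(4)}=\bigoplus_{i,j,k,p,q,l\in I}\bigl(\mathcal H^F_{ijk,pql}\oplus\mathcal H^G_{ijk,pql}\bigr),$$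 and let $\mathbb F:\mathcal H^{(4)}\to\mathbb k$ be the linear map with $$\mathbb F(\beta\otimes\bar\delta\otimes\alpha\otimes\bar\gamma)=\sqrt{d_ld_{\bar l}}\;F^{(ijk)l}_{pq;\alpha\beta\gamma\delta},\qquad \mathbb F(\bar\beta\otimes\delta\otimes\bar\alpha\otimes\gamma)=\sqrt{d_ld_{\bar l}}\;G^{(ijk)l}_{qp;\gamma\delta\alpha\beta}$$ on basis elements of $\mathcal H^F_{ijk,pql}$ and $\mathcal H^G_{ijk,pql}$ (this does not depend on the bases). **The maps $\tau$.** For $\alpha\in H_{ij}^{\,k}$ and $\theta\in H^{ij}_{\,k}$ put $$L\alpha=(\mathrm{id}\otimes\alpha)\circ(\cup_i\otimes\mathrm{id})\in H^{\bar i k}_{\,j},\quad R\alpha=(\alpha\otimes\mathrm{id})\circ(\mathrm{id}\otimes\cup'_j)\in H^{k\bar j}_{\,i},\quad L\theta=(\cap_i\otimes\mathrm{id})\circ(\mathrm{id}\otimes\theta)\in H_{\bar i k}^{\,j},\quad R\theta=(\mathrm{id}\otimes\cap'_j)\circ(\theta\otimes\mathrm{id})\in H_{k\bar j}^{\,i}.$$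 Let $\tau_{12},\tau_{23},\tau_{34}:\mathcal H^{(4)}\to\mathcal H^{(4)}$ be the linear maps with $$\tau_{12}(\beta\otimes\bar\delta\otimes\alpha\otimes\bar\gamma)=\bar\delta\otimes\beta\otimes L\alpha\otimes L\bar\gamma\in\mathcal H^G_{\bar iqk,ljp},$$ $$\tau_{23}(\beta\otimes\bar\delta\otimes\alpha\otimes\bar\gamma)=L\beta\otimes\alpha\otimes\bar\delta\otimes R\bar\gamma\in\mathcal H^G_{q\bar jp,kil},$$ $$\tau_{34}(\beta\otimes\bar\delta\otimes\alpha\otimes\bar\gamma)=R\beta\otimes R\bar\delta\otimes\bar\gamma\otimes\alpha\in\mathcal H^G_{ip\bar k,jlq}$$ on $\mathcal H^F_{ijk,pql}$, and given by the same formulas, with morphisms in $H_{\cdot\cdot}^{\;\cdot}$ and in $H^{\cdot\cdot}_{\;\cdot}$ interchanged, as maps from $\mathcal H^G_{ijk,pql}$ to the summands $\mathcal H^F$ with the same labels. **Statement.** There is a rigidity $r$ for which left and right dimensions coincide, $d_i=d_{\bar i}$ for all $i\in I$. For every such $r$, every space $H_{ij}^{\,k}$ has an eigenbasis, and the following two conditions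 are equivalent: 1. the maps $\tau_{12},\tau_{23},\tau_{34}$ generate an $\mathfrak S_4$-action on $\mathcal H^{(4)}$ (that is, there is a linear action of $\mathfrak S_4$ in which the transpositions $(12),(23),(34)$ act as $\tau_{12},\tau_{23},\tau_{34}$) that leaves $\mathbb F$ invariant; 2. the signs $\varepsilon_\alpha$ are all equal to $1$. -/

import Mathlib

open CategoryTheory MonoidalCategory CategoryTheory.Limits

universe w v u t

noncomputable section

attribute [local instance] Abelian.hasFiniteBiproducts

/-- A fusion category over `K`: a `K`-linear abelian monoidal category with `K`-bilinear tensor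
product that is semisimple and rigid, has finite-dimensional morphism spaces and finitely many
isomorphism classes of simple objects, and has a simple monoidal unit. -/
class FusionCategory (K : Type w) [Field K] (C : Type u) [Category.{v} C] [Abelian C] [Linear K C]
    [MonoidalCategory C] [MonoidalPreadditive C] [MonoidalLinear K C] : Prop where
  finiteDimensional : ∀ x y : C, FiniteDimensional K (x ⟶ y)
  semisimple : ∀ x : C, ∃ (n : ℕ) (s : Fin n → C), (∀ a, Simple (s a)) ∧ Nonempty (x ≅ ⨁ s)
  finitelyManySimples : ∃ (n : ℕ) (s : Fin n → C), ∀ x : C, Simple x → ∃ a, Nonempty (x ≅ s a)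
  simple_unit : Simple (𝟙_ C)
  rigid : Nonempty (RigidCategory C)

attribute [instance] FusionCategory.finiteDimensional

/-- A set of representatives for the isomorphism classes of simple objects, labelled by `I`. -/
structure SimpleReps (C : Type u) [Category.{v} C] [HasZeroMorphisms C] (I : Type t) where
  obj : I → C
  simple : ∀ i, Simple (obj i)
  eq_of_iso : ∀ i j, Nonempty (obj i ≅ obj j) → i = j
  exists_iso : ∀ x : C, Simple x → ∃ i, Nonempty (x ≅ obj i)

attribute [instance] SimpleReps.simple

namespace FusionCategory

section Scalar

variable (K : Type w) [Field K] [IsAlgClosed K] {C : Type u} [Category.{v} C] [Abelian C]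
  [Linear K C] [MonoidalCategory C] [MonoidalPreadditive C] [MonoidalLinear K C]
  [FusionCategory K C]

/-- `K ≃ End x`, `c ↦ c • 𝟙 x`, for a simple object `x`. -/
def scalarEquiv (x : C) [Simple x] : K ≃ₗ[K] (x ⟶ x) :=
  LinearEquiv.ofBijective (LinearMap.toSpanSingleton K (x ⟶ x) (𝟙 x))
    ⟨by
      rw [← LinearMap.ker_eq_bot, LinearMap.ker_toSpanSingleton K (id_nonzero x)],
     fun f => by
      obtain ⟨c, hc⟩ := endomorphism_simple_eq_smul_id K f
      exact ⟨c, by simpa using hc⟩⟩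

/-- The scalar `c` with `f = c • 𝟙 x`, for an endomorphism `f` of a simple object `x`. -/
def scalar (x : C) [Simple x] : (x ⟶ x) →ₗ[K] K := (scalarEquiv K x).symm.toLinearMap

theorem scalar_smul_id (x : C) [Simple x] (f : x ⟶ x) : scalar K x f • 𝟙 x = f := by
  exact (scalarEquiv K x).apply_symm_apply f

end Scalar

/-- The (right) dual `f^∨ : y' ⟶ x'` of a morphism `f : x ⟶ y` with respect to evaluations and
coevaluations `x' ⊗ x ⟶ 𝟙`, `𝟙 ⟶ x ⊗ x'`, `y' ⊗ y ⟶ 𝟙`, `𝟙 ⟶ y ⊗ y'`. -/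
def dualMorphism {C : Type u} [Category.{v} C] [MonoidalCategory C] {x x' y y' : C}
    (hx : ExactPairing x x') (hy : ExactPairing y y') (f : x ⟶ y) : y' ⟶ x' :=
  @rightAdjointMate C _ _ x y { rightDual := x', exact := hx } { rightDual := y', exact := hy } f

end FusionCategory

open FusionCategory

/-- A choice of rigidity on the chosen simple objects: an involution `i ↦ bar i` of the labels and,
whenever `j = bar i`, a coevaluation `𝟙 ⟶ X_j ⊗ X_i` and an evaluation `X_i ⊗ X_j ⟶ 𝟙` which satisfy
the snake identities. Since `bar` is an involution, this makes `X_(bar i)` both a left and a right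
dual of `X_i`; it determines the duals of all morphisms between tensor products of the `X_i`. -/
structure Rigidity {C : Type u} [Category.{v} C] [HasZeroMorphisms C] [MonoidalCategory C]
    {I : Type t} (S : SimpleReps C I) where
  bar : I → I
  bar_bar : ∀ i, bar (bar i) = i
  pairing : ∀ {i j : I}, bar i = j → ExactPairing (S.obj j) (S.obj i)

namespace Rigidity

section Cups

variable {C : Type u} [Category.{v} C] [HasZeroMorphisms C] [MonoidalCategory C]
  {I : Type t} {S : SimpleReps C I} (r : Rigidity S)

/-- `X_(bar i)` as left dual of `X_i`. -/
@[reducible] def left (i : I) : ExactPairing (S.obj (r.bar i)) (S.obj i) := r.pairing rfl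

/-- `X_(bar i)` as right dual of `X_i`; this is the pairing of `X_(bar i)` with its left
dual `X_(bar (bar i)) = X_i`. -/
@[reducible] def right (i : I) : ExactPairing (S.obj i) (S.obj (r.bar i)) := r.pairing (r.bar_bar i)

def cup (i : I) : 𝟙_ C ⟶ S.obj (r.bar i) ⊗ S.obj i := (r.left i).coevaluation'

def cap' (i : I) : S.obj i ⊗ S.obj (r.bar i) ⟶ 𝟙_ C := (r.left i).evaluation'

def cup' (i : I) : 𝟙_ C ⟶ S.obj i ⊗ S.obj (r.bar i) := (r.right i).coevaluation'

def cap (i : I) : S.obj (r.bar i) ⊗ S.obj i ⟶ 𝟙_ C := (r.right i).evaluation'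

/-- The double dual `α^∨∨` of `α : X_i ⊗ X_j ⟶ X_k`. Here `α^∨` is a morphism
`X_(bar k) ⟶ X_(bar j) ⊗ X_(bar i)`; cups and caps of tensor products are the nested ones. -/
def doubleDual (i j k : I) (f : S.obj i ⊗ S.obj j ⟶ S.obj k) : S.obj i ⊗ S.obj j ⟶ S.obj k :=
  dualMorphism (r.left k)
    (@ExactPairing.tensor C _ _ _ _ _ _ (r.left j) (r.left i))
    (dualMorphism (@ExactPairing.tensor C _ _ _ _ _ _ (r.right i) (r.right j)) (r.right k) f)

end Cups

variable {K : Type w} [Field K] {C : Type u} [Category.{v} C] [Abelian C]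
  [Linear K C] [MonoidalCategory C] [MonoidalPreadditive C] [MonoidalLinear K C]
  {I : Type t} {S : SimpleReps C I} (r : Rigidity S)

section Dim

variable (K) [IsAlgClosed K] [FusionCategory K C]

/-- The left dimension of `X_i`: the left trace of the identity. -/
def dimL (i : I) : K :=
  haveI : Simple (𝟙_ C) := FusionCategory.simple_unit K
  scalar K (𝟙_ C) (r.cup' i ≫ r.cap' i)

/-- The right dimension of `X_i`: the right trace of the identity. -/
def dimR (i : I) : K :=
  haveI : Simple (𝟙_ C) := FusionCategory.simple_unit K
  scalar K (𝟙_ C) (r.cup i ≫ r.cap i)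

/-- Left and right dimensions coincide. -/
def EqualDims : Prop := ∀ i, r.dimL K i = r.dimR K i

/-- A choice `D i` of square roots of the paired dimensions `dimL i * dimR i`; when the two
dimensions are equal, the root of the square `dimL i * dimR i = (dimL i) ^ 2` is `dimL i`. -/
structure IsRoot (D : I → K) : Prop where
  sq : ∀ i, D i ^ 2 = r.dimL K i * r.dimR K i
  coherent : ∀ i, r.dimL K i = r.dimR K i → D i = r.dimL K i

variable {K}

/-- The square root of `dd i * dd j * dd (bar k)`, where `dd i = dimL i / dimR i` is the relative
dimension, with square root `dimL i / D i`. -/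
def relRoot (D : I → K) (i j k : I) : K :=
  (r.dimL K i / D i) * (r.dimL K j / D j) * (r.dimR K k / D k)

/-- `f` is an eigenvector of the double dual with sign `ε`. -/
def HasSign (D : I → K) (i j k : I) (ε : K) (f : S.obj i ⊗ S.obj j ⟶ S.obj k) : Prop :=
  f ≠ 0 ∧ r.doubleDual i j k f = (ε * r.relRoot D i j k) • f

/-- `b` is an eigenbasis: it consists of eigenvectors of the double dual whose signs are `±1`. -/
def IsEigenbasis (D : I → K) (i j k : I) {n : ℕ}
    (b : Module.Basis (Fin n) K (S.obj i ⊗ S.obj j ⟶ S.obj k)) : Prop :=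
  ∀ a, ∃ ε : K, (ε = 1 ∨ ε = -1) ∧ r.HasSign D i j k ε (b a)

end Dim

section PartialDuals

variable (K)

/-- Modified framed left partial dual, on `Hom(X_i ⊗ X_j, X_k)`. -/
def partialL (i j k : I) :
    (S.obj i ⊗ S.obj j ⟶ S.obj k) →ₗ[K] (S.obj j ⟶ S.obj (r.bar i) ⊗ S.obj k) where
  toFun f := (λ_ _).inv ≫ r.cup i ▷ S.obj j ≫ (α_ _ _ _).hom ≫ S.obj (r.bar i) ◁ f
  map_add' f g := by simp
  map_smul' c f := by simp

/-- Modified framed left partial dual, on `Hom(X_k, X_i ⊗ X_j)`. -/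
def coPartialL (i j k : I) :
    (S.obj k ⟶ S.obj i ⊗ S.obj j) →ₗ[K] (S.obj (r.bar i) ⊗ S.obj k ⟶ S.obj j) where
  toFun f := S.obj (r.bar i) ◁ f ≫ (α_ _ _ _).inv ≫ r.cap i ▷ S.obj j ≫ (λ_ _).hom
  map_add' f g := by simp
  map_smul' c f := by simp

/-- Modified framed right partial dual, on `Hom(X_i ⊗ X_j, X_k)`. -/
def partialR (i j k : I) :
    (S.obj i ⊗ S.obj j ⟶ S.obj k) →ₗ[K] (S.obj i ⟶ S.obj k ⊗ S.obj (r.bar j)) where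
  toFun f := (ρ_ _).inv ≫ S.obj i ◁ r.cup' j ≫ (α_ _ _ _).inv ≫ f ▷ S.obj (r.bar j)
  map_add' f g := by simp
  map_smul' c f := by simp

/-- Modified framed right partial dual, on `Hom(X_k, X_i ⊗ X_j)`. -/
def coPartialR (i j k : I) :
    (S.obj k ⟶ S.obj i ⊗ S.obj j) →ₗ[K] (S.obj k ⊗ S.obj (r.bar j) ⟶ S.obj i) where
  toFun f := f ▷ S.obj (r.bar j) ≫ (α_ _ _ _).hom ≫ S.obj i ◁ r.cap' j ≫ (ρ_ _).hom
  map_add' f g := by simp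
  map_smul' c f := by simp

end PartialDuals

end Rigidity

/-- Sextuples of labels of simple objects. -/
@[ext] structure Labels (I : Type t) where
  i : I
  j : I
  k : I
  p : I
  q : I
  l : I

instance (I : Type t) : DecidableEq (Labels I) := Classical.decEq _

/-- The four-fold tensor product of `K`-modules. -/
abbrev Tensor4 (K : Type w) [Field K] (V₁ V₂ V₃ V₄ : Type v)
    [AddCommGroup V₁] [AddCommGroup V₂] [AddCommGroup V₃] [AddCommGroup V₄]
    [Module K V₁] [Module K V₂] [Module K V₃] [Module K V₄] : Type v :=
  TensorProduct K (TensorProduct K (TensorProduct K V₁ V₂) V₃) V₄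

/-- The pure tensor `x₁ ⊗ x₂ ⊗ x₃ ⊗ x₄`. -/
abbrev tmul4 (K : Type w) [Field K] {V₁ V₂ V₃ V₄ : Type v}
    [AddCommGroup V₁] [AddCommGroup V₂] [AddCommGroup V₃] [AddCommGroup V₄]
    [Module K V₁] [Module K V₂] [Module K V₃] [Module K V₄]
    (x₁ : V₁) (x₂ : V₂) (x₃ : V₃) (x₄ : V₄) : Tensor4 K V₁ V₂ V₃ V₄ :=
  TensorProduct.tmul K (TensorProduct.tmul K (TensorProduct.tmul K x₁ x₂) x₃) x₄

section Spaces

variable (K : Type w) [Field K] {C : Type u} [Category.{v} C] [Abelian C]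
  [Linear K C] [MonoidalCategory C] {I : Type t} (S : SimpleReps C I)

/-- `Hom(jk,p) ⊗ Hom(l,qk) ⊗ Hom(ip,l) ⊗ Hom(q,ij)`. -/
abbrev HF (a : Labels I) : Type v :=
  Tensor4 K (S.obj a.j ⊗ S.obj a.k ⟶ S.obj a.p) (S.obj a.l ⟶ S.obj a.q ⊗ S.obj a.k)
    (S.obj a.i ⊗ S.obj a.p ⟶ S.obj a.l) (S.obj a.q ⟶ S.obj a.i ⊗ S.obj a.j)

/-- `Hom(p,jk) ⊗ Hom(qk,l) ⊗ Hom(l,ip) ⊗ Hom(ij,q)`. -/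
abbrev HG (a : Labels I) : Type v :=
  Tensor4 K (S.obj a.p ⟶ S.obj a.j ⊗ S.obj a.k) (S.obj a.q ⊗ S.obj a.k ⟶ S.obj a.l)
    (S.obj a.l ⟶ S.obj a.i ⊗ S.obj a.p) (S.obj a.i ⊗ S.obj a.j ⟶ S.obj a.q)

/-- The direct sum over all sextuples of labels of the spaces `HF ⊕ HG`. -/
abbrev H4 : Type (max t v) := DirectSum (Labels I) fun a => HF K S a × HG K S a

/-- The inclusion of the summand `HF a`. -/
def inF (a : Labels I) : HF K S a →ₗ[K] H4 K S :=
  DirectSum.lof K (Labels I) (fun a => HF K S a × HG K S a) a ∘ₗ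
    LinearMap.inl K (HF K S a) (HG K S a)

/-- The inclusion of the summand `HG a`. -/
def inG (a : Labels I) : HG K S a →ₗ[K] H4 K S :=
  DirectSum.lof K (Labels I) (fun a => HF K S a × HG K S a) a ∘ₗ
    LinearMap.inr K (HF K S a) (HG K S a)

variable {K S}

/-- The linear map on `H4` given by linear maps on its summands. -/
def fromSummands {V : Type*} [AddCommMonoid V] [Module K V]
    (f : ∀ a, HF K S a →ₗ[K] V) (g : ∀ a, HG K S a →ₗ[K] V) : H4 K S →ₗ[K] V :=
  DirectSum.toModule K (Labels I) V fun a => LinearMap.coprod (f a) (g a)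

theorem fromSummands_inF {V : Type*} [AddCommMonoid V] [Module K V]
    (f : ∀ a, HF K S a →ₗ[K] V) (g : ∀ a, HG K S a →ₗ[K] V) (a : Labels I) (x : HF K S a) :
    fromSummands f g (inF K S a x) = f a x := by
  simp [fromSummands, inF]

theorem fromSummands_inG {V : Type*} [AddCommMonoid V] [Module K V]
    (f : ∀ a, HF K S a →ₗ[K] V) (g : ∀ a, HG K S a →ₗ[K] V) (a : Labels I) (x : HG K S a) :
    fromSummands f g (inG K S a x) = g a x := by
  simp [fromSummands, inG]

end Spaces

section SixJ

variable (K : Type w) [Field K] [IsAlgClosed K] {C : Type u} [Category.{v} C] [Abelian C]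
  [Linear K C] [MonoidalCategory C] [MonoidalPreadditive C] [MonoidalLinear K C]
  [FusionCategory K C] {I : Type t} (S : SimpleReps C I)

/-- The `6j`-symbol `F^{(i j k) l}_{p q; α β γ δ}` as a function of `α`, `β` and of the covectors
`γ'`, `δ'` dual to the basis vectors `γ`, `δ`; see `sixJ_spec` for the defining property. -/
def sixJ (i j k l p q : I) (α : S.obj i ⊗ S.obj p ⟶ S.obj l) (β : S.obj j ⊗ S.obj k ⟶ S.obj p)
    (γ' : S.obj q ⟶ S.obj i ⊗ S.obj j) (δ' : S.obj l ⟶ S.obj q ⊗ S.obj k) : K :=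
  scalar K (S.obj l) (δ' ≫ γ' ▷ S.obj k ≫ (α_ _ _ _).hom ≫ S.obj i ◁ β ≫ α)

/-- The inverse `6j`-symbol `G^{(i j k) l}_{p q; α β γ δ}` as a function of `α`, `β` and of the
covectors `γ'`, `δ'` dual to the basis vectors `γ`, `δ`; see `sixJInv_spec`. -/
def sixJInv (i j k l p q : I) (α : S.obj i ⊗ S.obj j ⟶ S.obj p)
    (β : S.obj p ⊗ S.obj k ⟶ S.obj l) (γ' : S.obj l ⟶ S.obj i ⊗ S.obj q)
    (δ' : S.obj q ⟶ S.obj j ⊗ S.obj k) : K :=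
  scalar K (S.obj l) (γ' ≫ S.obj i ◁ δ' ≫ (α_ _ _ _).inv ≫ α ▷ S.obj k ≫ β)

section Spec

set_option linter.unusedSectionVars false

variable {K S} [Fintype I]

theorem hom_eq_zero {i j : I} (h : i ≠ j) (f : S.obj i ⟶ S.obj j) : f = 0 := by
  by_contra hf
  have := isIso_of_hom_simple hf
  exact h (S.eq_of_iso i j ⟨asIso f⟩)

/-- Completeness relation for dual bases. -/
theorem sum_dual_bases (x : C) {n : I → ℕ} (b : ∀ q, Module.Basis (Fin (n q)) K (x ⟶ S.obj q))
    (b' : ∀ q, Module.Basis (Fin (n q)) K (S.obj q ⟶ x))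
    (h : ∀ q a c, b' q a ≫ b q c = if a = c then 𝟙 _ else 0) :
    ∑ q, ∑ a, b q a ≫ b' q a = 𝟙 x := by
  classical
  have key : ∀ (m : I) (f : S.obj m ⟶ x), f ≫ ∑ q, ∑ a, b q a ≫ b' q a = f := by
    intro m f
    have : Linear.rightComp K (S.obj m) (∑ q, ∑ a, b q a ≫ b' q a) = LinearMap.id := by
      refine (b' m).ext fun c => ?_
      simp only [Linear.rightComp_apply, Preadditive.comp_sum, LinearMap.id_apply]
      rw [Finset.sum_eq_single m]
      · simp only [← Category.assoc, h]
        simp [ite_comp]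
      · intro q _ hq
        refine Finset.sum_eq_zero fun a _ => ?_
        rw [← Category.assoc, hom_eq_zero hq.symm (b' m c ≫ b q a), zero_comp]
      · simp
    simpa using LinearMap.congr_fun this f
  obtain ⟨n, s, hs, ⟨e⟩⟩ := FusionCategory.semisimple (K := K) x
  rw [← cancel_epi e.inv]
  refine biproduct.hom_ext' _ _ fun a => ?_
  obtain ⟨m, ⟨g⟩⟩ := S.exists_iso (s a) (hs a)
  rw [← cancel_epi g.inv]
  simpa using key m (g.inv ≫ biproduct.ι s a ≫ e.inv)

/-- Expansion of a morphism `g : x ⟶ X_l` in a basis. -/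
theorem eq_sum_scalar (x : C) {n : I → ℕ} (b : ∀ q, Module.Basis (Fin (n q)) K (x ⟶ S.obj q))
    (b' : ∀ q, Module.Basis (Fin (n q)) K (S.obj q ⟶ x))
    (h : ∀ q a c, b' q a ≫ b q c = if a = c then 𝟙 _ else 0) (l : I) (g : x ⟶ S.obj l) :
    g = ∑ δ, scalar K (S.obj l) (b' l δ ≫ g) • b l δ := by
  conv_lhs => rw [← Category.id_comp g, ← sum_dual_bases x b b' h]
  simp only [Preadditive.sum_comp, Category.assoc]
  rw [Finset.sum_eq_single l]
  · refine Finset.sum_congr rfl fun δ _ => ?_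
    conv_lhs => rw [← scalar_smul_id K (S.obj l) (b' l δ ≫ g)]
    simp
  · intro m _ hm
    refine Finset.sum_eq_zero fun a _ => ?_
    rw [hom_eq_zero hm (b' m a ≫ g), comp_zero]
  · simp

/-- The numbers `sixJ` are the matrix elements of the associator (a `6j`-symbol in the
usual sense): for all dual bases,
`α ∘ (𝟙 ⊗ β) ∘ a = ∑_{q, γ, δ} F^{(i j k) l}_{p q; α β γ δ} δ ∘ (γ ⊗ 𝟙)`. -/
theorem sixJ_spec
    {n : I → I → I → ℕ}
    (b : ∀ i j q, Module.Basis (Fin (n i j q)) K (S.obj i ⊗ S.obj j ⟶ S.obj q))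
    (b' : ∀ i j q, Module.Basis (Fin (n i j q)) K (S.obj q ⟶ S.obj i ⊗ S.obj j))
    (h : ∀ i j q a c, b' i j q a ≫ b i j q c = if a = c then 𝟙 _ else 0)
    (i j k l p : I) (α : S.obj i ⊗ S.obj p ⟶ S.obj l)
    (β : S.obj j ⊗ S.obj k ⟶ S.obj p) :
    (α_ _ _ _).hom ≫ S.obj i ◁ β ≫ α =
      ∑ q, ∑ γ, ∑ δ, sixJ K S i j k l p q α β (b' i j q γ) (b' q k l δ) •
        (b i j q γ ▷ S.obj k ≫ b q k l δ) := by
  classical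
  have h1 := sum_dual_bases (K := K) _ (b i j) (b' i j) (h i j)
  have h3 := congrArg (fun f => f ▷ S.obj k ≫ (α_ _ _ _).hom ≫ S.obj i ◁ β ≫ α) h1
  simp only [id_whiskerRight, Category.id_comp] at h3
  rw [← h3, sum_whiskerRight, Preadditive.sum_comp]
  refine Finset.sum_congr rfl fun q _ => ?_
  rw [sum_whiskerRight, Preadditive.sum_comp]
  refine Finset.sum_congr rfl fun γ _ => ?_
  rw [comp_whiskerRight, Category.assoc,
    eq_sum_scalar _ (b q k) (b' q k) (h q k) l (b' i j q γ ▷ S.obj k ≫ (α_ _ _ _).hom ≫ S.obj i ◁ β ≫ α), Preadditive.comp_sum]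
  refine Finset.sum_congr rfl fun δ _ => ?_
  simp [sixJ]

/-- The numbers `sixJInv` are the matrix elements of the inverse associator: for all dual bases,
`β ∘ (α ⊗ 𝟙) ∘ a⁻¹ = ∑_{q, γ, δ} G^{(i j k) l}_{p q; α β γ δ} γ ∘ (𝟙 ⊗ δ)`. -/
theorem sixJInv_spec
    {n : I → I → I → ℕ}
    (b : ∀ i j q, Module.Basis (Fin (n i j q)) K (S.obj i ⊗ S.obj j ⟶ S.obj q))
    (b' : ∀ i j q, Module.Basis (Fin (n i j q)) K (S.obj q ⟶ S.obj i ⊗ S.obj j))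
    (h : ∀ i j q a c, b' i j q a ≫ b i j q c = if a = c then 𝟙 _ else 0)
    (i j k l p : I) (α : S.obj i ⊗ S.obj j ⟶ S.obj p)
    (β : S.obj p ⊗ S.obj k ⟶ S.obj l) :
    (α_ _ _ _).inv ≫ α ▷ S.obj k ≫ β =
      ∑ q, ∑ δ, ∑ γ, sixJInv K S i j k l p q α β (b' i q l γ) (b' j k q δ) •
        (S.obj i ◁ b j k q δ ≫ b i q l γ) := by
  classical
  have h3 := congrArg (fun f => S.obj i ◁ f ≫ (α_ _ _ _).inv ≫ α ▷ S.obj k ≫ β)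
    (sum_dual_bases _ (b j k) (b' j k) (h j k))
  simp only [whiskerLeft_id, Category.id_comp] at h3
  rw [← h3, whiskerLeft_sum, Preadditive.sum_comp]
  refine Finset.sum_congr rfl fun q _ => ?_
  rw [whiskerLeft_sum, Preadditive.sum_comp]
  refine Finset.sum_congr rfl fun δ _ => ?_
  rw [whiskerLeft_comp, Category.assoc,
    eq_sum_scalar _ (b i q) (b' i q) (h i q) l
      (S.obj i ◁ b' j k q δ ≫ (α_ _ _ _).inv ≫ α ▷ S.obj k ≫ β), Preadditive.comp_sum]
  refine Finset.sum_congr rfl fun γ _ => ?_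
  simp [sixJInv]

end Spec

variable {S} in
/-- The summand of `𝔽` on `HF a`: `β ⊗ δ' ⊗ α ⊗ γ' ↦ D_l F^{(ijk)l}_{pq;αβγδ}`. -/
def bbF (D : I → K) (a : Labels I) : HF K S a →ₗ[K] K :=
  TensorProduct.lift <| TensorProduct.lift <| TensorProduct.lift <|
    LinearMap.mk₂ K
      (fun β δ' => LinearMap.mk₂ K
        (fun α γ' => D a.l * sixJ K S a.i a.j a.k a.l a.p a.q α β γ' δ')
        (by intros; simp [sixJ, mul_add]) (by intros; simp [sixJ, mul_left_comm])
        (by intros; simp [sixJ, mul_add]) (by intros; simp [sixJ, mul_left_comm]))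
      (by intros; ext; simp [sixJ, mul_add]) (by intros; ext; simp [sixJ, mul_left_comm])
      (by intros; ext; simp [sixJ, mul_add]) (by intros; ext; simp [sixJ, mul_left_comm])

variable {S} in
/-- The summand of `𝔽` on `HG a`: `δ' ⊗ β ⊗ γ' ⊗ α ↦ D_l G^{(ijk)l}_{qp;αβγδ}`. -/
def bbG (D : I → K) (a : Labels I) : HG K S a →ₗ[K] K :=
  TensorProduct.lift <| TensorProduct.lift <| TensorProduct.lift <|
    LinearMap.mk₂ K
      (fun δ' β => LinearMap.mk₂ K
        (fun γ' α => D a.l * sixJInv K S a.i a.j a.k a.l a.q a.p α β γ' δ')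
        (by intros; simp [sixJInv, mul_add]) (by intros; simp [sixJInv, mul_left_comm])
        (by intros; simp [sixJInv, mul_add]) (by intros; simp [sixJInv, mul_left_comm]))
      (by intros; ext; simp [sixJInv, mul_add]) (by intros; ext; simp [sixJInv, mul_left_comm])
      (by intros; ext; simp [sixJInv, mul_add]) (by intros; ext; simp [sixJInv, mul_left_comm])

variable {S}

theorem bbF_tmul (D : I → K) (a : Labels I) (β : S.obj a.j ⊗ S.obj a.k ⟶ S.obj a.p)
    (δ' : S.obj a.l ⟶ S.obj a.q ⊗ S.obj a.k) (α : S.obj a.i ⊗ S.obj a.p ⟶ S.obj a.l)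
    (γ' : S.obj a.q ⟶ S.obj a.i ⊗ S.obj a.j) :
    bbF K D a (tmul4 K β δ' α γ') =
      D a.l * sixJ K S a.i a.j a.k a.l a.p a.q α β γ' δ' := rfl

theorem bbG_tmul (D : I → K) (a : Labels I) (δ' : S.obj a.p ⟶ S.obj a.j ⊗ S.obj a.k)
    (β : S.obj a.q ⊗ S.obj a.k ⟶ S.obj a.l) (γ' : S.obj a.l ⟶ S.obj a.i ⊗ S.obj a.p)
    (α : S.obj a.i ⊗ S.obj a.j ⟶ S.obj a.q) :
    bbG K D a (tmul4 K δ' β γ' α) =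
      D a.l * sixJInv K S a.i a.j a.k a.l a.q a.p α β γ' δ' := rfl

/-- The function `𝔽` on `H4`: rescaled `6j`-symbols on the summands `HF`, rescaled inverse
`6j`-symbols on the summands `HG`, where `D l` plays the role of the square root of the paired
dimension of `X_l`. -/
def FTotal (D : I → K) : H4 K S →ₗ[K] K := fromSummands (bbF K D) (bbG K D)

end SixJ

namespace Rigidity

variable (K : Type w) [Field K] {C : Type u} [Category.{v} C] [Abelian C]
  [Linear K C] [MonoidalCategory C] [MonoidalPreadditive C] [MonoidalLinear K C]
  {I : Type t} {S : SimpleReps C I} (r : Rigidity S)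

def label12 (a : Labels I) : Labels I :=
  { i := r.bar a.i, j := a.q, k := a.k, p := a.l, q := a.j, l := a.p }

def label23 (a : Labels I) : Labels I :=
  { i := a.q, j := r.bar a.j, k := a.p, p := a.k, q := a.i, l := a.l }

def label34 (a : Labels I) : Labels I :=
  { i := a.i, j := a.p, k := r.bar a.k, p := a.j, q := a.l, l := a.q }

open TensorProduct (map comm rightComm)

/-- `β ⊗ δ' ⊗ α ⊗ γ' ↦ δ' ⊗ β ⊗ Lα ⊗ Lγ'`. -/
def tau12F (a : Labels I) : HF K S a →ₗ[K] HG K S (r.label12 a) :=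
  map (map (comm K _ _).toLinearMap (r.partialL K a.i a.p a.l)) (r.coPartialL K a.i a.j a.q)

/-- `β' ⊗ δ ⊗ α' ⊗ γ ↦ δ ⊗ β' ⊗ Lα' ⊗ Lγ`. -/
def tau12G (a : Labels I) : HG K S a →ₗ[K] HF K S (r.label12 a) :=
  map (map (comm K _ _).toLinearMap (r.coPartialL K a.i a.p a.l)) (r.partialL K a.i a.j a.q)

/-- `β ⊗ δ' ⊗ α ⊗ γ' ↦ Lβ ⊗ α ⊗ δ' ⊗ Rγ'`. -/
def tau23F (a : Labels I) : HF K S a →ₗ[K] HG K S (r.label23 a) :=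
  map (map (map (r.partialL K a.j a.k a.p) .id) .id ∘ₗ (rightComm K _ _ _).toLinearMap)
    (r.coPartialR K a.i a.j a.q)

/-- `β' ⊗ δ ⊗ α' ⊗ γ ↦ Lβ' ⊗ α' ⊗ δ ⊗ Rγ`. -/
def tau23G (a : Labels I) : HG K S a →ₗ[K] HF K S (r.label23 a) :=
  map (map (map (r.coPartialL K a.j a.k a.p) .id) .id ∘ₗ (rightComm K _ _ _).toLinearMap)
    (r.partialR K a.i a.j a.q)

/-- `β ⊗ δ' ⊗ α ⊗ γ' ↦ Rβ ⊗ Rδ' ⊗ γ' ⊗ α`. -/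
def tau34F (a : Labels I) : HF K S a →ₗ[K] HG K S (r.label34 a) :=
  map (map (map (r.partialR K a.j a.k a.p) (r.coPartialR K a.q a.k a.l)) .id) .id ∘ₗ
    (rightComm K _ _ _).toLinearMap

/-- `β' ⊗ δ ⊗ α' ⊗ γ ↦ Rβ' ⊗ Rδ ⊗ γ ⊗ α'`. -/
def tau34G (a : Labels I) : HG K S a →ₗ[K] HF K S (r.label34 a) :=
  map (map (map (r.coPartialR K a.j a.k a.p) (r.partialR K a.q a.k a.l)) .id) .id ∘ₗ
    (rightComm K _ _ _).toLinearMap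

theorem tau12F_tmul (a : Labels I) (β : S.obj a.j ⊗ S.obj a.k ⟶ S.obj a.p)
    (δ' : S.obj a.l ⟶ S.obj a.q ⊗ S.obj a.k) (α : S.obj a.i ⊗ S.obj a.p ⟶ S.obj a.l)
    (γ' : S.obj a.q ⟶ S.obj a.i ⊗ S.obj a.j) :
    r.tau12F K a (tmul4 K β δ' α γ') =
      tmul4 K δ' β (r.partialL K _ _ _ α) (r.coPartialL K _ _ _ γ') := rfl

theorem tau23F_tmul (a : Labels I) (β : S.obj a.j ⊗ S.obj a.k ⟶ S.obj a.p)
    (δ' : S.obj a.l ⟶ S.obj a.q ⊗ S.obj a.k) (α : S.obj a.i ⊗ S.obj a.p ⟶ S.obj a.l)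
    (γ' : S.obj a.q ⟶ S.obj a.i ⊗ S.obj a.j) :
    r.tau23F K a (tmul4 K β δ' α γ') =
      tmul4 K (r.partialL K _ _ _ β) α δ' (r.coPartialR K _ _ _ γ') := rfl

theorem tau34F_tmul (a : Labels I) (β : S.obj a.j ⊗ S.obj a.k ⟶ S.obj a.p)
    (δ' : S.obj a.l ⟶ S.obj a.q ⊗ S.obj a.k) (α : S.obj a.i ⊗ S.obj a.p ⟶ S.obj a.l)
    (γ' : S.obj a.q ⟶ S.obj a.i ⊗ S.obj a.j) :
    r.tau34F K a (tmul4 K β δ' α γ') =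
      tmul4 K (r.partialR K _ _ _ β) (r.coPartialR K _ _ _ δ') γ' α := rfl

theorem tau12G_tmul (a : Labels I) (β' : S.obj a.p ⟶ S.obj a.j ⊗ S.obj a.k)
    (δ : S.obj a.q ⊗ S.obj a.k ⟶ S.obj a.l) (α' : S.obj a.l ⟶ S.obj a.i ⊗ S.obj a.p)
    (γ : S.obj a.i ⊗ S.obj a.j ⟶ S.obj a.q) :
    r.tau12G K a (tmul4 K β' δ α' γ) =
      tmul4 K δ β' (r.coPartialL K _ _ _ α') (r.partialL K _ _ _ γ) := rfl

theorem tau23G_tmul (a : Labels I) (β' : S.obj a.p ⟶ S.obj a.j ⊗ S.obj a.k)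
    (δ : S.obj a.q ⊗ S.obj a.k ⟶ S.obj a.l) (α' : S.obj a.l ⟶ S.obj a.i ⊗ S.obj a.p)
    (γ : S.obj a.i ⊗ S.obj a.j ⟶ S.obj a.q) :
    r.tau23G K a (tmul4 K β' δ α' γ) =
      tmul4 K (r.coPartialL K _ _ _ β') α' δ (r.partialR K _ _ _ γ) := rfl

theorem tau34G_tmul (a : Labels I) (β' : S.obj a.p ⟶ S.obj a.j ⊗ S.obj a.k)
    (δ : S.obj a.q ⊗ S.obj a.k ⟶ S.obj a.l) (α' : S.obj a.l ⟶ S.obj a.i ⊗ S.obj a.p)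
    (γ : S.obj a.i ⊗ S.obj a.j ⟶ S.obj a.q) :
    r.tau34G K a (tmul4 K β' δ α' γ) =
      tmul4 K (r.coPartialR K _ _ _ β') (r.partialR K _ _ _ δ) γ α' := rfl

def tau12 : H4 K S →ₗ[K] H4 K S :=
  fromSummands (fun a => inG K S (r.label12 a) ∘ₗ r.tau12F K a)
    (fun a => inF K S (r.label12 a) ∘ₗ r.tau12G K a)

def tau23 : H4 K S →ₗ[K] H4 K S :=
  fromSummands (fun a => inG K S (r.label23 a) ∘ₗ r.tau23F K a)
    (fun a => inF K S (r.label23 a) ∘ₗ r.tau23G K a)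

def tau34 : H4 K S →ₗ[K] H4 K S :=
  fromSummands (fun a => inG K S (r.label34 a) ∘ₗ r.tau34F K a)
    (fun a => inF K S (r.label34 a) ∘ₗ r.tau34G K a)

/-- The maps `τ₁₂`, `τ₂₃`, `τ₃₄` generate an action of the symmetric group on four letters on `H4`
(in which they are the actions of the standard transpositions), and the induced action
`(σ • 𝔽) x = 𝔽 (σ⁻¹ • x)` leaves `𝔽` invariant. -/
def TetrahedralSymmetry [IsAlgClosed K] [FusionCategory K C] (D : I → K) : Prop :=
  ∃ ρ : Representation K (Equiv.Perm (Fin 4)) (H4 K S),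
    ρ (Equiv.swap 0 1) = r.tau12 K ∧ ρ (Equiv.swap 1 2) = r.tau23 K ∧
      ρ (Equiv.swap 2 3) = r.tau34 K ∧
      ∀ (σ : Equiv.Perm (Fin 4)) (x : H4 K S), FTotal K D (ρ σ⁻¹ x) = FTotal K D x

end Rigidity

end

/-! The partial duals `L` and `R` are Frobenius reciprocity bijections, and on covectors they are
inverses of such bijections. The double dual of `α : X_i ⊗ X_j ⟶ X_k` is a composite of six of them.
Moving three to the other side turns `α^∨∨ = α` into the braid identity `LRL α = RLR α`
(`tensorBidual_eq_iff`).

The maps τ permute tensor factors and dualise two of them. They square to the identity, and τ₁₂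
commutes with τ₃₄. In each of the two braid relations the two sides can differ in one factor only,
and there they differ by the braid identity or its analogue for covectors. So a trivial double dual
yields the Coxeter relations, hence an action of the symmetric group. Conversely, evaluating the
braid relation of τ₂₃ and τ₃₄ on a pure tensor with `α` in the first factor and non-zero morphisms
in the others returns the braid identity for `α`.

For invariance, a `6j`-symbol times a dimension is the value of a closed diagram. Sliding a morphism
once around a loop replaces it by its double dual (`trL_comp`, `trR_comp`). If double duals are
trivial, τ₁₂ and τ₃₄ therefore only change the strand at which the diagram is cut open; invariance
under τ₂₃ is a snake identity.

The same trace identities show that the double dual is an involution when left and right dimensions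
coincide (`doubleDual_doubleDual`). It is then diagonalisable with eigenvalues ±1, which are the
signs, and all signs are 1 exactly when it is the identity. Equal dimensions are reached by
rescaling cups and caps with square roots of the dimensions. -/

open FusionCategory

noncomputable section

attribute [local instance] Abelian.hasFiniteBiproducts

/-! ### Frobenius reciprocity, mates and traces for explicit dual pairs. -/

namespace MonoidalTrace

variable {C : Type u} [Category.{v} C] [MonoidalCategory C]

/-- Frobenius reciprocity on the left, for an explicit pairing. -/
abbrev lE {X Y Y' Z : C} (P : ExactPairing Y Y') : (Y' ⊗ X ⟶ Z) ≃ (X ⟶ Y ⊗ Z) :=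
  @tensorLeftHomEquiv C _ _ X Y Y' Z P

/-- Frobenius reciprocity on the right, for an explicit pairing. -/
abbrev rE {X Y Y' Z : C} (P : ExactPairing Y Y') : (X ⊗ Y ⟶ Z) ≃ (X ⟶ Z ⊗ Y') :=
  @tensorRightHomEquiv C _ _ X Y Y' Z P

/-- The tensor product of two pairings. -/
abbrev tensorPairing {X X' Y Y' : C} (P : ExactPairing X X') (Q : ExactPairing Y Y') :
    ExactPairing (X ⊗ Y) (Y' ⊗ X') :=
  @ExactPairing.tensor C _ _ _ _ _ _ P Q

theorem tensorPairing_coevaluation' {X X' Y Y' : C} (P : ExactPairing X X')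
    (Q : ExactPairing Y Y') : (tensorPairing P Q).coevaluation' =
      P.coevaluation' ⊗≫ (X ◁ Q.coevaluation') ▷ X' ⊗≫ 𝟙 _ := rfl

theorem tensorPairing_evaluation' {X X' Y Y' : C} (P : ExactPairing X X')
    (Q : ExactPairing Y Y') : (tensorPairing P Q).evaluation' =
      𝟙 _ ⊗≫ Y' ◁ (P.evaluation' ▷ Y) ⊗≫ Q.evaluation' := rfl

theorem lE_apply {X Y Y' Z : C} (P : ExactPairing Y Y') (f : Y' ⊗ X ⟶ Z) :
    lE P f = (λ_ _).inv ≫ P.coevaluation' ▷ _ ≫ (α_ _ _ _).hom ≫ _ ◁ f := rfl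

theorem lE_symm_apply {X Y Y' Z : C} (P : ExactPairing Y Y') (f : X ⟶ Y ⊗ Z) :
    (lE P).symm f = Y' ◁ f ≫ (α_ _ _ _).inv ≫ P.evaluation' ▷ _ ≫ (λ_ _).hom := rfl

theorem rE_apply {X Y Y' Z : C} (P : ExactPairing Y Y') (f : X ⊗ Y ⟶ Z) :
    rE P f = (ρ_ _).inv ≫ _ ◁ P.coevaluation' ≫ (α_ _ _ _).inv ≫ f ▷ _ := rfl

theorem rE_symm_apply {X Y Y' Z : C} (P : ExactPairing Y Y') (f : X ⟶ Z ⊗ Y') :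
    (rE P).symm f = f ▷ _ ≫ (α_ _ _ _).hom ≫ _ ◁ P.evaluation' ≫ (ρ_ _).hom := rfl

/-- The trace closing the strand to the left. -/
def trL {z z' : C} (P : ExactPairing z z') (Q : ExactPairing z' z) (f : z ⟶ z) : 𝟙_ C ⟶ 𝟙_ C :=
  Q.coevaluation' ≫ z' ◁ f ≫ P.evaluation'

/-- The trace closing the strand to the right. -/
def trR {z z' : C} (P : ExactPairing z z') (Q : ExactPairing z' z) (f : z ⟶ z) : 𝟙_ C ⟶ 𝟙_ C :=
  P.coevaluation' ≫ f ▷ z' ≫ Q.evaluation'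

section Mates

variable {x x' y y' : C}

theorem dualMorphism_comp_evaluation (P : ExactPairing x x') (Q : ExactPairing y y')
    (f : x ⟶ y) : dualMorphism P Q f ▷ x ≫ P.evaluation' = y' ◁ f ≫ Q.evaluation' :=
  @rightAdjointMate_comp_evaluation C _ _ x y { rightDual := x', exact := P }
    { rightDual := y', exact := Q } f

theorem coevaluation_comp_dualMorphism (P : ExactPairing x x') (Q : ExactPairing y y')
    (f : x ⟶ y) : Q.coevaluation' ≫ y ◁ dualMorphism P Q f = P.coevaluation' ≫ f ▷ x' :=
  @coevaluation_comp_rightAdjointMate C _ _ x y { rightDual := x', exact := P }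
    { rightDual := y', exact := Q } f

/-- The double dual of a morphism, with respect to two-sided duals. -/
def bidual (P : ExactPairing x x') (P' : ExactPairing x' x) (Q : ExactPairing y y')
    (Q' : ExactPairing y' y) (f : x ⟶ y) : x ⟶ y :=
  dualMorphism Q' P' (dualMorphism P Q f)

variable (P : ExactPairing x x') (P' : ExactPairing x' x) (Q : ExactPairing y y')
  (Q' : ExactPairing y' y) (f : x ⟶ y) (g : y ⟶ x)

/-- Cyclicity up to a double dual: `f` passes the cap and becomes its dual on the return strand,
moves past `g` by the exchange law, and passes the cup to come back as the double dual. -/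
theorem trL_comp : trL Q Q' (g ≫ f) = trL P P' (bidual P P' Q Q' f ≫ g) := by
  have h1 := dualMorphism_comp_evaluation P Q f
  have h2 := coevaluation_comp_dualMorphism Q' P' (dualMorphism P Q f)
  simp only [trL, bidual, whiskerLeft_comp, Category.assoc]
  rw [← h1, whisker_exchange_assoc, ← reassoc_of% h2]

theorem trR_comp : trR P P' (f ≫ g) = trR Q Q' (g ≫ bidual P P' Q Q' f) := by
  have h1 := dualMorphism_comp_evaluation Q' P' (dualMorphism P Q f)
  have h2 := coevaluation_comp_dualMorphism P Q f
  simp only [trR, bidual, comp_whiskerRight, Category.assoc]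
  rw [← reassoc_of% h2, h1, ← whisker_exchange_assoc]

end Mates

section Tensor

variable {x x' y y' z z' : C}

/-- With nested cups, the strands of `f` can be bent one at a time: `y`, then `z`, then `x`. -/
theorem dualMorphism_tensor_source (P₁ : ExactPairing x x') (P₂ : ExactPairing y y')
    (P : ExactPairing z z') (f : x ⊗ y ⟶ z) :
    dualMorphism (tensorPairing P₁ P₂) P f = rE P₁ ((lE P).symm (rE P₂ f)) := by
  rw [rE_apply, lE_symm_apply, rE_apply]
  simp only [dualMorphism, rightAdjointMate, ExactPairing.coevaluation,
    ExactPairing.evaluation, tensorPairing_coevaluation']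
  monoidal

theorem dualMorphism_tensor_target (P : ExactPairing z' z) (P₁ : ExactPairing y' y)
    (P₂ : ExactPairing x' x) (g : z' ⟶ y' ⊗ x') :
    dualMorphism P (tensorPairing P₁ P₂) g = (lE P₂).symm (rE P ((lE P₁).symm g)) := by
  rw [lE_symm_apply, rE_apply, lE_symm_apply]
  simp only [dualMorphism, rightAdjointMate, ExactPairing.coevaluation,
    ExactPairing.evaluation, tensorPairing_evaluation']
  monoidal

variable (P₁ : ExactPairing x x') (Q₁ : ExactPairing x' x) (P₂ : ExactPairing y y')
  (Q₂ : ExactPairing y' y) (P : ExactPairing z z') (Q : ExactPairing z' z)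
  (f : x ⊗ y ⟶ z) (g : z ⟶ x ⊗ y)

/-- The loop of a tensor product consists of two nested loops; closing the `x` strand first leaves a
loop on `y` that carries the two partial duals. -/
theorem trL_tensor : trL (tensorPairing P₁ P₂) (tensorPairing Q₂ Q₁) (f ≫ g) =
    trL P₂ Q₂ (lE Q₁ f ≫ (lE P₁).symm g) := by
  rw [lE_apply, lE_symm_apply]
  simp only [trL, tensorPairing_coevaluation', tensorPairing_evaluation']
  monoidal

theorem trR_tensor : trR (tensorPairing P₁ P₂) (tensorPairing Q₂ Q₁) (f ≫ g) =
    trR P₁ Q₁ (rE P₂ f ≫ (rE Q₂).symm g) := by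
  rw [rE_apply, rE_symm_apply]
  simp only [trR, tensorPairing_coevaluation', tensorPairing_evaluation']
  monoidal

/-- Both sides are the diagram with `x` closed to the left and `y` to the right; they differ only in
the order in which the two cups, and the two caps, are applied. -/
theorem trR_lE_eq_trL_rE : trR P₂ Q₂ (lE Q₁ f ≫ (lE P₁).symm g) =
    trL P₁ Q₁ (rE P₂ f ≫ (rE Q₂).symm g) := by
  rw [lE_apply, lE_symm_apply, rE_apply, rE_symm_apply, trR, trL]
  set η₁ := Q₁.coevaluation'
  set η₂ := P₂.coevaluation'
  set ε₁ := P₁.evaluation'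
  set ε₂ := Q₂.evaluation'
  calc
    _ = 𝟙 _ ⊗≫ (𝟙_ C ◁ η₂ ≫ η₁ ▷ (y ⊗ y')) ⊗≫ x' ◁ (f ≫ g) ▷ y' ⊗≫
          (ε₁ ▷ (y ⊗ y') ≫ 𝟙_ C ◁ ε₂) ⊗≫ 𝟙 _ := by monoidal
    _ = 𝟙 _ ⊗≫ (η₁ ▷ 𝟙_ C ≫ (x' ⊗ x) ◁ η₂) ⊗≫ x' ◁ (f ≫ g) ▷ y' ⊗≫
          ((x' ⊗ x) ◁ ε₂ ≫ ε₁ ▷ 𝟙_ C) ⊗≫ 𝟙 _ := by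
      rw [whisker_exchange, whisker_exchange]
    _ = _ := by monoidal

/-- The double dual of `f : x ⊗ y ⟶ z`. -/
abbrev tensorBidual : x ⊗ y ⟶ z :=
  bidual (tensorPairing P₁ P₂) (tensorPairing Q₂ Q₁) P Q f

theorem tensorBidual_eq_iff : tensorBidual P₁ Q₁ P₂ Q₂ P Q f = f ↔
    lE Q₂ ((rE Q).symm (lE Q₁ f)) = rE P₁ ((lE P).symm (rE P₂ f)) := by
  rw [tensorBidual, bidual, dualMorphism_tensor_target, dualMorphism_tensor_source]
  rw [Equiv.symm_apply_eq, ← Equiv.eq_symm_apply, Equiv.symm_apply_eq, eq_comm]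

theorem trL_comp_tensorBidual : trL P Q (g ≫ f) =
    trL P₂ Q₂ (lE Q₁ (tensorBidual P₁ Q₁ P₂ Q₂ P Q f) ≫ (lE P₁).symm g) := by
  rw [trL_comp (tensorPairing P₁ P₂) (tensorPairing Q₂ Q₁), trL_tensor]

theorem trR_comp_tensorBidual : trR P Q (g ≫ tensorBidual P₁ Q₁ P₂ Q₂ P Q f) =
    trR P₁ Q₁ (rE P₂ f ≫ (rE Q₂).symm g) := by
  rw [← trR_comp (tensorPairing P₁ P₂) (tensorPairing Q₂ Q₁), trR_tensor]

end Tensor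

section Slides

variable {x x' y y' z w p q : C}

/-- The bent strand `x` leaves the composite through `g` alone, so by the exchange law only `g` gets
dualised. -/
theorem lE_symm_comp (P : ExactPairing x x') (f : z ⟶ q ⊗ w) (g : q ⟶ x ⊗ y) (h : y ⊗ w ⟶ p) :
    (lE P).symm (f ≫ g ▷ w ≫ (α_ _ _ _).hom ≫ x ◁ h) =
      x' ◁ f ≫ (α_ _ _ _).inv ≫ (lE P).symm g ▷ w ≫ h := by
  rw [lE_symm_apply, lE_symm_apply]
  set ε := P.evaluation'
  calc
    _ = x' ◁ f ⊗≫ x' ◁ g ▷ w ⊗≫ ((x' ⊗ x) ◁ h ≫ ε ▷ p) ⊗≫ 𝟙 _ := by monoidal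
    _ = x' ◁ f ⊗≫ x' ◁ g ▷ w ⊗≫ (ε ▷ (y ⊗ w) ≫ 𝟙_ C ◁ h) ⊗≫ 𝟙 _ := by rw [whisker_exchange]
    _ = _ := by monoidal

theorem rE_comp (P : ExactPairing y y') (g : q ⟶ x ⊗ w) (h : w ⊗ y ⟶ p) (f : x ⊗ p ⟶ z) :
    rE P (g ▷ y ≫ (α_ _ _ _).hom ≫ x ◁ h ≫ f) =
      g ≫ x ◁ rE P h ≫ (α_ _ _ _).inv ≫ f ▷ y' := by
  rw [rE_apply, rE_apply]
  set η := P.coevaluation'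
  calc
    _ = 𝟙 _ ⊗≫ (q ◁ η ≫ g ▷ (y ⊗ y')) ⊗≫ x ◁ h ▷ y' ⊗≫ f ▷ y' := by monoidal
    _ = 𝟙 _ ⊗≫ (g ▷ 𝟙_ C ≫ (x ⊗ w) ◁ η) ⊗≫ x ◁ h ▷ y' ⊗≫ f ▷ y' := by rw [whisker_exchange]
    _ = _ := by monoidal

/-- A snake across an associator. -/
theorem whiskerLeft_lE_comp_rE_symm (Q : ExactPairing y' y) (g : q ⟶ x ⊗ y) (h : y ⊗ w ⟶ p) :
    q ◁ lE Q h ≫ (α_ _ _ _).inv ≫ (rE Q).symm g ▷ p =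
      g ▷ w ≫ (α_ _ _ _).hom ≫ x ◁ h := by
  simp only [lE, rE, tensorLeftHomEquiv, tensorRightHomEquiv, Equiv.coe_fn_mk,
    Equiv.coe_fn_symm_mk]
  calc
    _ = 𝟙 _ ⊗≫ q ◁ η_ y' y ▷ w ⊗≫ ((q ⊗ y') ◁ h ≫ (g ▷ y' ⊗≫ x ◁ ε_ y' y ⊗≫ 𝟙 x) ▷ p) ⊗≫ 𝟙 _ := by
      monoidal
    _ = 𝟙 _ ⊗≫ (q ◁ η_ y' y ≫ g ▷ (y' ⊗ y)) ▷ w ⊗≫ x ◁ ε_ y' y ▷ (y ⊗ w) ⊗≫ x ◁ h := by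
      rw [whisker_exchange]; monoidal
    _ = g ▷ w ⊗≫ x ◁ (y ◁ η_ y' y ⊗≫ ε_ y' y ▷ y) ▷ w ⊗≫ x ◁ h := by
      rw [whisker_exchange]; monoidal
    _ = _ := by
      rw [ExactPairing.coevaluation_evaluation'']; monoidal

end Slides

section Nondegenerate

variable {x y : C}

theorem coevaluation_whiskerLeft_injective (P : ExactPairing x y) {z : C} {f g : y ⟶ z}
    (h : P.coevaluation' ≫ x ◁ f = P.coevaluation' ≫ x ◁ g) : f = g := by
  have h1 : lE P ((ρ_ y).hom ≫ f) = lE P ((ρ_ y).hom ≫ g) := by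
    rw [lE_apply, lE_apply]
    have : ∀ f : y ⟶ z, (λ_ _).inv ≫ P.coevaluation' ▷ _ ≫ (α_ _ _ _).hom ≫
        x ◁ ((ρ_ y).hom ≫ f) = P.coevaluation' ≫ x ◁ f := fun f => by
      monoidal
    rw [this, this, h]
  exact (cancel_epi _).1 ((lE P).injective h1)

theorem exists_coevaluation_whiskerLeft (P : ExactPairing x y) {z : C} (h : 𝟙_ C ⟶ x ⊗ z) :
    ∃ f : y ⟶ z, h = P.coevaluation' ≫ x ◁ f := by
  refine ⟨(ρ_ y).inv ≫ (lE P).symm h, ?_⟩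
  conv_lhs => rw [← (lE P).apply_symm_apply h, lE_apply]
  monoidal

theorem exists_coevaluation_whiskerRight (P : ExactPairing x y) {z : C} (h : 𝟙_ C ⟶ z ⊗ y) :
    ∃ f : x ⟶ z, h = P.coevaluation' ≫ f ▷ y := by
  refine ⟨(λ_ x).inv ≫ (rE P).symm h, ?_⟩
  conv_lhs => rw [← (rE P).apply_symm_apply h, rE_apply]
  monoidal

variable [Preadditive C] [MonoidalPreadditive C]

theorem coevaluation_ne_zero (P : ExactPairing x y) (hx : 𝟙 x ≠ 0) : P.coevaluation' ≠ 0 := by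
  intro h
  apply hx
  have := P.evaluation_coevaluation'
  rw [h] at this
  simp only [MonoidalPreadditive.zero_whiskerRight, zero_comp] at this
  rw [← cancel_epi (λ_ x).hom, ← cancel_mono (ρ_ x).inv]
  simpa using this.symm

theorem evaluation_ne_zero (P : ExactPairing x y) (hx : 𝟙 x ≠ 0) : P.evaluation' ≠ 0 := by
  intro h
  apply hx
  have := P.evaluation_coevaluation'
  rw [h] at this
  simp only [MonoidalPreadditive.whiskerLeft_zero, comp_zero] at this
  rw [← cancel_epi (λ_ x).hom, ← cancel_mono (ρ_ x).inv]
  simpa using this.symm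

end Nondegenerate

end MonoidalTrace

/-! ### Semisimplicity and duals of simple objects. -/

namespace FusionCategory

open MonoidalTrace

variable (K : Type w) [Field K] {C : Type u} [Category.{v} C] [Abelian C]
  [Linear K C] [MonoidalCategory C] [MonoidalPreadditive C] [MonoidalLinear K C]
  [FusionCategory K C]

-- On a semisimple object a non-zero `f` is non-zero on some simple summand, where it is invertible
-- by Schur's lemma.
include K in
theorem exists_section {x s : C} [Simple s] {f : x ⟶ s} (hf : f ≠ 0) :
    ∃ g : s ⟶ x, g ≫ f = 𝟙 s := by
  obtain ⟨n, t, ht, ⟨e⟩⟩ := FusionCategory.semisimple (K := K) x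
  by_contra! hcon
  apply hf
  rw [← cancel_epi e.inv]
  refine biproduct.hom_ext' _ _ fun a => ?_
  by_contra hne
  have := ht a
  have := isIso_of_hom_simple (f := biproduct.ι t a ≫ e.inv ≫ f) (by simpa using hne)
  exact hcon (inv (biproduct.ι t a ≫ e.inv ≫ f) ≫ biproduct.ι t a ≫ e.inv)
    (by simp only [Category.assoc, IsIso.inv_hom_id])

/-- A non-zero object all of whose endomorphisms are scalars is simple. -/
theorem simple_of_scalar_end {x : C} (h0 : 𝟙 x ≠ 0) (h : ∀ f : x ⟶ x, ∃ c : K, f = c • 𝟙 x) :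
    Simple x := by
  obtain ⟨n, t, ht, ⟨e⟩⟩ := FusionCategory.semisimple (K := K) x
  have : ∃ a : Fin n, True := by
    by_contra! hn
    apply h0
    rw [← cancel_epi e.inv]
    exact biproduct.hom_ext' _ _ fun a => (hn a).elim
  obtain ⟨a, -⟩ := this
  have := ht a
  let i : t a ⟶ x := biproduct.ι t a ≫ e.inv
  let p : x ⟶ t a := e.hom ≫ biproduct.π t a
  have hip : i ≫ p = 𝟙 _ := by simp [i, p]
  -- The idempotent `p ≫ i` is a scalar fixing `i ≠ 0`, so the scalar is 1 and the chosen summand is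
  -- all of `x`.
  obtain ⟨c, hc⟩ := h (p ≫ i)
  have hpi : p ≫ i = 𝟙 x := by
    have h1 : c • i = i := by
      have := congrArg (fun f => i ≫ f) hc
      simpa [reassoc_of% hip] using this.symm
    have hi : i ≠ 0 := fun hi => id_nonzero (t a) (by rw [← hip, hi, zero_comp])
    have h2 : (c - 1) • i = 0 := by rw [sub_smul, h1, one_smul, sub_self]
    have h3 : c = 1 := sub_eq_zero.1 ((smul_eq_zero.1 h2).resolve_right hi)
    rw [hc, h3, one_smul]
  exact Simple.of_iso ⟨p, i, hpi, hip⟩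

section Pairing

variable {x y : C}

variable [IsAlgClosed K]

include K in
/-- A right dual of a simple object is simple. -/
theorem simple_rightDual (P : ExactPairing x y) [Simple x] : Simple y := by
  refine simple_of_scalar_end K (fun hy => ?_) fun f => ?_
  · refine coevaluation_ne_zero P (id_nonzero x) ?_
    rw [← Category.comp_id P.coevaluation', ← whiskerLeft_id, hy]
    simp
  -- Across the cup, an endomorphism of `y` corresponds to an endomorphism of `x`, which is a
  -- scalar.
  · obtain ⟨g, hg⟩ := exists_coevaluation_whiskerRight P (P.coevaluation' ≫ x ◁ f)
    obtain ⟨c, rfl⟩ := endomorphism_simple_eq_smul_id K g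
    refine ⟨c, coevaluation_whiskerLeft_injective P ?_⟩
    rw [hg]
    simp

include K in
/-- A left dual of a simple object is also a right dual. -/
theorem nonempty_pairing_symm (P : ExactPairing x y) [Simple x] [Simple y] :
    Nonempty (ExactPairing y x) := by
  obtain ⟨hr⟩ := FusionCategory.rigid (K := K) (C := C)
  have R : ExactPairing y (HasRightDual.rightDual y) := HasRightDual.exact
  have : Simple (𝟙_ C) := FusionCategory.simple_unit K
  have := simple_rightDual K R
  -- A section of the evaluation corresponds to a non-zero map from the right dual of `y` to `x`;
  -- both are simple, so this map identifies them.
  obtain ⟨s, hs⟩ := exists_section K (evaluation_ne_zero P (id_nonzero x))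
  obtain ⟨f, hf⟩ := exists_coevaluation_whiskerLeft R s
  have hf0 : f ≠ 0 := by
    rintro rfl
    rw [hf] at hs
    simp at hs
    exact id_nonzero (𝟙_ C) hs.symm
  have := isIso_of_hom_simple hf0
  exact ⟨@exactPairingCongrRight C _ _ _ _ _ R (asIso f).symm⟩

-- All maps `𝟙 ⟶ x ⊗ y` are multiples of the coevaluation, and one of them is a section of the
-- evaluation, so the loop cannot vanish.
include K in
theorem coevaluation_comp_evaluation_ne_zero (P : ExactPairing x y) (Q : ExactPairing y x)
    [Simple x] : P.coevaluation' ≫ Q.evaluation' ≠ 0 := by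
  intro h
  have : Simple (𝟙_ C) := FusionCategory.simple_unit K
  have := simple_rightDual K P
  obtain ⟨s, hs⟩ := exists_section K (evaluation_ne_zero Q (id_nonzero y))
  obtain ⟨f, rfl⟩ := exists_coevaluation_whiskerLeft P s
  obtain ⟨c, rfl⟩ := endomorphism_simple_eq_smul_id K f
  rw [MonoidalLinear.whiskerLeft_smul, whiskerLeft_id, Linear.comp_smul, Category.comp_id,
    Linear.smul_comp, h, smul_zero] at hs
  exact id_nonzero (𝟙_ C) hs.symm

/-- A pairing rescaled by a non-zero number. -/
@[reducible]
def scalePairing (P : ExactPairing x y) (c : K) (hc : c ≠ 0) : ExactPairing x y where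
  coevaluation' := c • P.coevaluation'
  evaluation' := c⁻¹ • P.evaluation'
  coevaluation_evaluation' := by
    simp [smul_smul, hc, P.coevaluation_evaluation']
  evaluation_coevaluation' := by
    simp [smul_smul, hc, P.evaluation_coevaluation']

end Pairing

end FusionCategory

namespace FusionCategory

open MonoidalTrace

section Scalar

variable (K : Type w) [Field K] [IsAlgClosed K] {C : Type u} [Category.{v} C] [Abelian C]
  [Linear K C] [MonoidalCategory C] [MonoidalPreadditive C] [MonoidalLinear K C]
  [FusionCategory K C]

theorem scalar_ne_zero {x : C} [Simple x] {f : x ⟶ x} (hf : f ≠ 0) : scalar K x f ≠ 0 := by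
  intro h
  apply hf
  rw [← scalar_smul_id K x f, h, zero_smul]

theorem scalar_injective (x : C) [Simple x] : Function.Injective (scalar K x) :=
  (scalarEquiv K x).symm.injective

end Scalar

end FusionCategory

/-! ### Existence of a rigidity with equal left and right dimensions. -/

namespace Rigidity

open MonoidalTrace

section Existence

variable (K : Type w) [Field K] [IsAlgClosed K] {C : Type u} [Category.{v} C] [Abelian C]
  [Linear K C] [MonoidalCategory C] [MonoidalPreadditive C] [MonoidalLinear K C]
  [FusionCategory K C] {I : Type t} (S : SimpleReps C I)

include K in
theorem exists_rightDual_label (i : I) : ∃ j, Nonempty (ExactPairing (S.obj i) (S.obj j)) := by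
  obtain ⟨hr⟩ := FusionCategory.rigid (K := K) (C := C)
  have P : ExactPairing (S.obj i) (HasRightDual.rightDual (S.obj i)) := HasRightDual.exact
  have := simple_rightDual K P
  obtain ⟨j, ⟨e⟩⟩ := S.exists_iso _ this
  exact ⟨j, ⟨@exactPairingCongrRight C _ _ _ _ _ P e.symm⟩⟩

include K in
/-- Every fusion category has a rigidity. -/
theorem nonempty_of_fusionCategory : Nonempty (Rigidity S) := by
  choose bar hbar using exists_rightDual_label K S
  have hP : ∀ i, Nonempty (ExactPairing (S.obj (bar i)) (S.obj i)) := fun i =>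
    nonempty_pairing_symm K (hbar i).some
  refine ⟨{ bar := bar, bar_bar := fun i => ?_, pairing := fun {i j} h => ?_ }⟩
  -- Both objects are right duals of `X_(bar i)`.
  · exact S.eq_of_iso _ _ ⟨rightDualIso (hbar (bar i)).some (hP i).some⟩
  · exact h ▸ (hP i).some

variable {S} (r : Rigidity S)

variable {K} in
/-- A rigidity with rescaled cups and caps. -/
def rescale (c : I → K) (hc : ∀ i, c i ≠ 0) : Rigidity S where
  bar := r.bar
  bar_bar := r.bar_bar
  pairing {i _} h := scalePairing K (r.pairing h) (c i) (hc i)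

theorem dimL_ne_zero (i : I) : r.dimL K i ≠ 0 :=
  haveI : Simple (𝟙_ C) := FusionCategory.simple_unit K
  scalar_ne_zero K (coevaluation_comp_evaluation_ne_zero K (r.right i) (r.left i))

theorem dimL_bar (i : I) : r.dimL K (r.bar i) = r.dimR K i := by
  -- `bar (bar i)` equals `i` only propositionally; with a free label `k` in its place the equation
  -- can be substituted.
  have : ∀ (k : I) (_ : k = i) (hk : r.bar k = r.bar i) (hi : r.bar (r.bar i) = k),
      (r.pairing hk).coevaluation' ≫ (r.pairing hi).evaluation' = r.cup i ≫ r.cap i := by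
    rintro k rfl _ _
    rfl
  exact congrArg (@scalar K _ _ C _ _ _ _ _ _ _ (𝟙_ C) (FusionCategory.simple_unit K))
    (this _ (r.bar_bar i) (r.bar_bar (r.bar i)) rfl)

theorem dimL_rescale (c : I → K) (hc : ∀ i, c i ≠ 0) (i : I) :
    (r.rescale c hc).dimL K i = c (r.bar i) * (c i)⁻¹ * r.dimL K i := by
  have h : (r.rescale c hc).cup' i ≫ (r.rescale c hc).cap' i =
      (c (r.bar i) • r.cup' i) ≫ ((c i)⁻¹ • r.cap' i) := rfl
  rw [dimL, dimL, h, Linear.smul_comp, Linear.comp_smul, map_smul, map_smul, smul_eq_mul,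
    smul_eq_mul, mul_assoc]

theorem dimR_rescale (c : I → K) (hc : ∀ i, c i ≠ 0) (i : I) :
    (r.rescale c hc).dimR K i = c i * (c (r.bar i))⁻¹ * r.dimR K i := by
  have h : (r.rescale c hc).cup i ≫ (r.rescale c hc).cap i =
      (c i • r.cup i) ≫ ((c (r.bar i))⁻¹ • r.cap i) := rfl
  rw [dimR, dimR, h, Linear.smul_comp, Linear.comp_smul, map_smul, map_smul, smul_eq_mul,
    smul_eq_mul, mul_assoc]

/-- Every fusion category has a rigidity whose left and right dimensions coincide. -/
theorem exists_equalDims : ∃ r : Rigidity S, r.EqualDims K := by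
  obtain ⟨r⟩ := nonempty_of_fusionCategory K S
  -- With `c i ^ 2 = dimL i`, both rescaled dimensions become `c i * c (bar i)`.
  choose c hc using fun i => IsAlgClosed.exists_pow_nat_eq (r.dimL K i) (n := 2) (by norm_num)
  have hc0 : ∀ i, c i ≠ 0 := fun i h => r.dimL_ne_zero K i (by rw [← hc, h]; ring)
  refine ⟨r.rescale c hc0, fun i => ?_⟩
  rw [dimL_rescale, dimR_rescale, ← dimL_bar, ← hc, ← hc]
  field_simp [hc0]

end Existence

/-! ### The double dual as an involution. -/

section DoubleDual

variable {K : Type w} [Field K] [IsAlgClosed K] {C : Type u} [Category.{v} C] [Abelian C]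
  [Linear K C] [MonoidalCategory C] [MonoidalPreadditive C] [MonoidalLinear K C]
  [FusionCategory K C] {I : Type t} {S : SimpleReps C I} (r : Rigidity S)

/-- The loop closed to the left is `cup` followed by `cap`, hence the right dimension. -/
theorem trL_eq (i : I) (f : S.obj i ⟶ S.obj i) :
    trL (r.right i) (r.left i) f = (scalar K _ f * r.dimR K i) • 𝟙 _ := by
  have : Simple (𝟙_ C) := FusionCategory.simple_unit K
  generalize hc : scalar K _ f = c
  rw [← scalar_smul_id K _ f, hc, mul_smul, dimR, scalar_smul_id]
  simp [trL, cup, cap]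

theorem trR_eq (i : I) (f : S.obj i ⟶ S.obj i) :
    trR (r.right i) (r.left i) f = (scalar K _ f * r.dimL K i) • 𝟙 _ := by
  have : Simple (𝟙_ C) := FusionCategory.simple_unit K
  generalize hc : scalar K _ f = c
  rw [← scalar_smul_id K _ f, hc, mul_smul, dimL, scalar_smul_id]
  simp [trR, cup', cap']

omit [IsAlgClosed K] in
theorem smul_id_unit_injective {a b : K} (h : a • 𝟙 (𝟙_ C) = b • 𝟙 (𝟙_ C)) : a = b := by
  have : Simple (𝟙_ C) := FusionCategory.simple_unit K
  exact smul_left_injective K (id_nonzero (𝟙_ C)) h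

variable (i j k : I) (f : S.obj i ⊗ S.obj j ⟶ S.obj k) (g : S.obj k ⟶ S.obj i ⊗ S.obj j)

theorem scalar_comp_mul_dimR : scalar K _ (g ≫ f) * r.dimR K k =
    scalar K _ (r.partialL K i j k (r.doubleDual i j k f) ≫ r.coPartialL K i j k g) *
      r.dimR K j := by
  apply smul_id_unit_injective (C := C)
  rw [← trL_eq, ← trL_eq]
  exact trL_comp_tensorBidual (r.right i) (r.left i) (r.right j) (r.left j) (r.right k)
    (r.left k) f g

theorem scalar_comp_mul_dimL : scalar K _ (g ≫ r.doubleDual i j k f) * r.dimL K k =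
    scalar K _ (r.partialR K i j k f ≫ r.coPartialR K i j k g) * r.dimL K i := by
  apply smul_id_unit_injective (C := C)
  rw [← trR_eq, ← trR_eq]
  exact trR_comp_tensorBidual (r.right i) (r.left i) (r.right j) (r.left j) (r.right k)
    (r.left k) f g

theorem scalar_partialL_mul_dimL :
    scalar K _ (r.partialL K i j k f ≫ r.coPartialL K i j k g) * r.dimL K j =
    scalar K _ (r.partialR K i j k f ≫ r.coPartialR K i j k g) * r.dimR K i := by
  apply smul_id_unit_injective (C := C)
  rw [← trR_eq, ← trL_eq]
  exact trR_lE_eq_trL_rE (r.right i) (r.left i) (r.right j) (r.left j) f g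

variable {r}

/-- If left and right dimensions coincide, then the double dual is an involution. -/
theorem doubleDual_doubleDual (hr : r.EqualDims K) :
    r.doubleDual i j k (r.doubleDual i j k f) = f := by
  by_contra hne
  obtain ⟨g, hg⟩ := exists_section K (sub_ne_zero.2 hne)
  -- Cutting open the loop at `k`, `i`, `j` and again at `k` introduces one double dual on each of
  -- the two outer passages; equal dimensions make the loop factors agree.
  have h : scalar K _ (g ≫ r.doubleDual i j k (r.doubleDual i j k f)) = scalar K _ (g ≫ f) := by
    apply mul_right_cancel₀ (r.dimL_ne_zero K k)
    rw [scalar_comp_mul_dimL, hr i, ← scalar_partialL_mul_dimL, hr k, scalar_comp_mul_dimR, hr j]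
  rw [Preadditive.comp_sub, scalar_injective K _ h, sub_self] at hg
  exact id_nonzero _ hg.symm

variable (r) in
/-- The double dual as a linear map. -/
def doubleDualLinear : (S.obj i ⊗ S.obj j ⟶ S.obj k) →ₗ[K] (S.obj i ⊗ S.obj j ⟶ S.obj k) where
  toFun f := r.doubleDual i j k f
  map_add' f g := by simp [doubleDual, dualMorphism, rightAdjointMate]
  map_smul' c f := by simp [doubleDual, dualMorphism, rightAdjointMate]

theorem relRoot_eq_one (hr : r.EqualDims K) {D : I → K} (hD : r.IsRoot K D) :
    r.relRoot D i j k = 1 := by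
  have h : ∀ i, D i = r.dimL K i := fun i => hD.coherent i (hr i)
  have h0 := r.dimL_ne_zero K
  rw [relRoot, h, h, h, ← hr k, div_self (h0 i), div_self (h0 j), div_self (h0 k)]
  ring

theorem hasSign_iff (hr : r.EqualDims K) {D : I → K} (hD : r.IsRoot K D) (ε : K) :
    r.HasSign D i j k ε f ↔ f ≠ 0 ∧ r.doubleDual i j k f = ε • f := by
  rw [HasSign, relRoot_eq_one i j k hr hD, mul_one]

end DoubleDual

end Rigidity

/-! ### Eigenbases and signs. -/

section Involution

/-- An involution of a finite-dimensional vector space has a basis of eigenvectors. -/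
theorem LinearMap.exists_basis_of_involutive {K V : Type*} [Field K] [CharZero K] [AddCommGroup V]
    [Module K V] [FiniteDimensional K V] (T : V →ₗ[K] V) (hT : ∀ x, T (T x) = x) :
    ∃ (n : ℕ) (b : Module.Basis (Fin n) K V), ∀ a, T (b a) = b a ∨ T (b a) = - b a := by
  let U : Submodule K V := LinearMap.ker (T - LinearMap.id)
  let W : Submodule K V := LinearMap.ker (T + LinearMap.id)
  have hU : ∀ x, x ∈ U ↔ T x = x := fun x => by simp [U, sub_eq_zero]
  have hW : ∀ x, x ∈ W ↔ T x = -x := fun x => by simp [W, add_eq_zero_iff_eq_neg]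
  have hc : IsCompl U W := by
    refine IsCompl.of_eq ?_ ?_
    · rw [Submodule.eq_bot_iff]
      rintro x ⟨h1, h2⟩
      have h3 := (hU x).1 h1
      rw [(hW x).1 h2] at h3
      have h4 : (2 : K) • x = 0 := by
        rw [two_smul]
        nth_rewrite 1 [← h3]
        exact neg_add_cancel x
      exact (smul_eq_zero.1 h4).resolve_left two_ne_zero
    · rw [Submodule.eq_top_iff']
      intro x
      have hx : x = (2⁻¹ : K) • (x + T x) + (2⁻¹ : K) • (x - T x) := by
        rw [← smul_add, add_add_sub_cancel, ← two_smul K x, smul_smul,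
          inv_mul_cancel₀ two_ne_zero, one_smul]
      rw [hx]
      refine Submodule.add_mem_sup (U.smul_mem _ ((hU _).2 ?_)) (W.smul_mem _ ((hW _).2 ?_))
      · rw [map_add, hT, add_comm]
      · rw [map_sub, hT, neg_sub]
  let b := (((Module.finBasis K U).prod (Module.finBasis K W)).map
    (Submodule.prodEquivOfIsCompl U W hc)).reindex finSumFinEquiv
  refine ⟨_, b, fun a => ?_⟩
  obtain ⟨a, rfl⟩ := finSumFinEquiv.surjective a
  rcases a with a | a
  · left
    simpa [b] using (hU _).1 (Module.finBasis K U a).2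
  · right
    simpa [b] using (hW _).1 (Module.finBasis K W a).2

end Involution

namespace Rigidity

section Eigenbasis

variable {K : Type w} [Field K] [IsAlgClosed K] [CharZero K] {C : Type u} [Category.{v} C]
  [Abelian C] [Linear K C] [MonoidalCategory C] [MonoidalPreadditive C] [MonoidalLinear K C]
  [FusionCategory K C] {I : Type t} {S : SimpleReps C I} {r : Rigidity S}

theorem exists_isEigenbasis (hr : r.EqualDims K) {D : I → K} (hD : r.IsRoot K D) (i j k : I) :
    ∃ (n : ℕ) (b : Module.Basis (Fin n) K (S.obj i ⊗ S.obj j ⟶ S.obj k)),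
      r.IsEigenbasis D i j k b := by
  obtain ⟨n, b, hb⟩ := LinearMap.exists_basis_of_involutive (r.doubleDualLinear (K := K) i j k)
    fun f => doubleDual_doubleDual i j k f hr
  refine ⟨n, b, fun a => ?_⟩
  rcases hb a with h | h
  · exact ⟨1, .inl rfl, (hasSign_iff i j k _ hr hD 1).2 ⟨b.ne_zero a, by rw [one_smul]; exact h⟩⟩
  · exact ⟨-1, .inr rfl, (hasSign_iff i j k _ hr hD (-1)).2
      ⟨b.ne_zero a, by rw [neg_smul, one_smul]; exact h⟩⟩

theorem signs_eq_one_iff (hr : r.EqualDims K) {D : I → K} (hD : r.IsRoot K D) :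
    (∀ (i j k : I) (ε : K) (α : S.obj i ⊗ S.obj j ⟶ S.obj k),
      r.HasSign D i j k ε α → ε = 1) ↔
    ∀ (i j k : I) (α : S.obj i ⊗ S.obj j ⟶ S.obj k), r.doubleDual i j k α = α := by
  constructor
  · intro h i j k α
    by_contra hne
    -- The involution negates the difference of `α^∨∨` and `α`, so a non-zero difference would have
    -- sign -1.
    have := h i j k (-1) (r.doubleDualLinear (K := K) i j k α - α)
      ((hasSign_iff i j k _ hr hD (-1)).2 ⟨sub_ne_zero.2 hne, ?_⟩)
    · norm_num at this
    · change r.doubleDualLinear (K := K) i j k _ = _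
      rw [map_sub, neg_smul, one_smul, neg_sub]
      congr 1
      exact doubleDual_doubleDual i j k α hr
  · intro h i j k ε α hα
    obtain ⟨h0, h1⟩ := (hasSign_iff i j k α hr hD ε).1 hα
    rw [h] at h1
    have h2 : (ε - 1) • α = 0 := by rw [sub_smul, ← h1, one_smul, sub_self]
    exact sub_eq_zero.1 ((smul_eq_zero.1 h2).resolve_right h0)

end Eigenbasis

end Rigidity

/-! ### The Coxeter presentation of the symmetric group on four letters. -/

namespace SymmetricFour

section Words

variable {M : Type*} [Monoid M]

/-- The normal form, with label `x`, of a word in three generators. -/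
def word (s₁ s₂ s₃ : M) (x : Fin 2 × Fin 3 × Fin 4) : M :=
  ![1, s₁] x.1 * ![1, s₂, s₂ * s₁] x.2.1 * ![1, s₃, s₃ * s₂, s₃ * s₂ * s₁] x.2.2

/-- The Coxeter relations of the symmetric group on four letters. -/
structure Relations (s₁ s₂ s₃ : M) : Prop where
  sq₁ : s₁ * s₁ = 1
  sq₂ : s₂ * s₂ = 1
  sq₃ : s₃ * s₃ = 1
  comm : s₃ * s₁ = s₁ * s₃
  braid₁₂ : s₂ * s₁ * s₂ = s₁ * s₂ * s₁
  braid₂₃ : s₃ * s₂ * s₃ = s₂ * s₃ * s₂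

variable {s₁ s₂ s₃ : M} (h : Relations s₁ s₂ s₃)

include h

theorem exists_first_mul (a : Fin 2) : ∃ a' : Fin 2, ![1, s₁] a * s₁ = ![1, s₁] a' := by
  fin_cases a
  · exact ⟨1, by simp⟩
  · exact ⟨0, by simp [h.sq₁]⟩

theorem exists_second_mul (a : Fin 2) (b : Fin 3) (s : M) (hs : s = s₁ ∨ s = s₂) :
    ∃ (a' : Fin 2) (b' : Fin 3), ![1, s₁] a * ![1, s₂, s₂ * s₁] b * s =
      ![1, s₁] a' * ![1, s₂, s₂ * s₁] b' := by
  obtain ⟨a', ha'⟩ := exists_first_mul h a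
  rcases hs with rfl | rfl <;> fin_cases b
  · exact ⟨a', 0, by simpa using ha'⟩
  · exact ⟨a, 2, by simp [mul_assoc]⟩
  · exact ⟨a, 1, by simp [mul_assoc, h.sq₁]⟩
  · exact ⟨a, 1, by simp⟩
  · exact ⟨a, 0, by simp [mul_assoc, h.sq₂]⟩
  · refine ⟨a', 2, ?_⟩
    rw [← ha']
    simpa [mul_assoc] using congrArg (![1, s₁] a * ·) h.braid₁₂

/-- The third factors act as representatives of the cosets of the subgroup generated by `s₁` and
`s₂`: a generator multiplied on the right either changes the representative or comes out on the left
as `s₁` or `s₂`. -/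
theorem exists_third_mul (c : Fin 4) (s : M) (hs : s = s₁ ∨ s = s₂ ∨ s = s₃) :
    ∃ (s' : M) (c' : Fin 4), (s' = 1 ∨ s' = s₁ ∨ s' = s₂) ∧
      ![1, s₃, s₃ * s₂, s₃ * s₂ * s₁] c * s = s' * ![1, s₃, s₃ * s₂, s₃ * s₂ * s₁] c' := by
  have h13 := h.comm
  have h12 := h.braid₁₂
  have h23 := h.braid₂₃
  rcases hs with rfl | rfl | rfl <;> fin_cases c
  · exact ⟨s, 0, by simp⟩
  · exact ⟨s, 1, by simp [h13]⟩
  · exact ⟨1, 3, by simp⟩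
  · exact ⟨1, 2, by simp [mul_assoc, h.sq₁]⟩
  · exact ⟨s, 0, by simp⟩
  · exact ⟨1, 2, by simp⟩
  · exact ⟨1, 1, by simp [mul_assoc, h.sq₂]⟩
  · refine ⟨s₁, 3, by simp, ?_⟩
    change s₃ * s * s₁ * s = s₁ * (s₃ * s * s₁)
    rw [mul_assoc s₃, mul_assoc s₃, h12, ← mul_assoc, ← mul_assoc, h13]
    simp only [mul_assoc]
  · exact ⟨1, 1, by simp⟩
  · exact ⟨1, 0, by simp [h.sq₃]⟩
  · exact ⟨s₂, 2, by simp, by simpa [mul_assoc] using h23⟩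
  · refine ⟨s₂, 3, by simp, ?_⟩
    change s * s₂ * s₁ * s = s₂ * (s * s₂ * s₁)
    rw [mul_assoc (s * s₂), ← h13, ← mul_assoc, h23]
    simp only [mul_assoc]

theorem exists_word_mul (x : Fin 2 × Fin 3 × Fin 4) (s : M) (hs : s = s₁ ∨ s = s₂ ∨ s = s₃) :
    ∃ y, word s₁ s₂ s₃ x * s = word s₁ s₂ s₃ y := by
  obtain ⟨a, b, c⟩ := x
  obtain ⟨s', c', hs', hc⟩ := exists_third_mul h c s hs
  have : ∃ (a' : Fin 2) (b' : Fin 3), ![1, s₁] a * ![1, s₂, s₂ * s₁] b * s' =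
      ![1, s₁] a' * ![1, s₂, s₂ * s₁] b' := by
    rcases hs' with rfl | hs'
    · exact ⟨a, b, mul_one _⟩
    · exact exists_second_mul h a b s' hs'
  obtain ⟨a', b', hab⟩ := this
  refine ⟨(a', b', c'), ?_⟩
  simp only [word]
  rw [mul_assoc, hc, ← mul_assoc, hab]

end Words

open Equiv

theorem word_swap_bijective :
    Function.Bijective (word (swap (0 : Fin 4) 1) (swap 1 2) (swap 2 3)) := by
  rw [Fintype.bijective_iff_injective_and_card]
  exact ⟨by decide +kernel, by simp [Fintype.card_perm, Nat.factorial]⟩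

/-- The symmetric group on four letters is generated by adjacent transpositions. -/
theorem closure_swap : Submonoid.closure {swap (0 : Fin 4) 1, swap 1 2, swap 2 3} = ⊤ := by
  rw [← Perm.mclosure_swap_castSucc_succ 3]
  congr 1
  ext x
  simp [Fin.exists_fin_succ, eq_comm]

/-- The Coxeter presentation of the symmetric group on four letters. -/
theorem exists_monoidHom {M : Type*} [Monoid M] {s₁ s₂ s₃ : M} (h : Relations s₁ s₂ s₃) :
    ∃ ρ : Perm (Fin 4) →* M, ρ (swap 0 1) = s₁ ∧ ρ (swap 1 2) = s₂ ∧ ρ (swap 2 3) = s₃ := by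
  have hP : Relations (swap (0 : Fin 4) 1) (swap 1 2) (swap 2 3) :=
    ⟨by decide, by decide, by decide, by decide, by decide, by decide⟩
  -- Normal forms are computed in `M` and in the symmetric group simultaneously: the second
  -- coordinate determines the normal form, and the first shows that `ρ` respects multiplication by
  -- generators.
  have hN : Relations (M := M × Perm (Fin 4)) (s₁, swap 0 1) (s₂, swap 1 2) (s₃, swap 2 3) :=
    ⟨Prod.ext h.sq₁ hP.sq₁, Prod.ext h.sq₂ hP.sq₂, Prod.ext h.sq₃ hP.sq₃,
      Prod.ext h.comm hP.comm, Prod.ext h.braid₁₂ hP.braid₁₂, Prod.ext h.braid₂₃ hP.braid₂₃⟩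
  have hw : ∀ x, word (M := M × Perm (Fin 4)) (s₁, swap 0 1) (s₂, swap 1 2) (s₃, swap 2 3) x =
      (word s₁ s₂ s₃ x, word (swap 0 1) (swap 1 2) (swap 2 3) x) := by
    rintro ⟨a, b, c⟩
    fin_cases a <;> fin_cases b <;> fin_cases c <;> rfl
  let e := Equiv.ofBijective _ word_swap_bijective
  let ρ : Perm (Fin 4) → M := fun σ => word s₁ s₂ s₃ (e.symm σ)
  have hone : ρ 1 = 1 := by
    have : e.symm 1 = (0, 0, 0) := by
      rw [Equiv.symm_apply_eq]
      rfl
    simp only [ρ, this]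
    simp [word]
  have hgen : ∀ (σ : Perm (Fin 4)) (s : M) (p : Perm (Fin 4)),
      ((s, p) = (s₁, swap 0 1) ∨ (s, p) = (s₂, swap 1 2) ∨ (s, p) = (s₃, swap 2 3)) →
      ρ (σ * p) = ρ σ * s := by
    intro σ s p hs
    obtain ⟨y, hy⟩ := exists_word_mul hN (e.symm σ) (s, p) hs
    rw [hw, hw] at hy
    have h1 : word s₁ s₂ s₃ (e.symm σ) * s = word s₁ s₂ s₃ y := congrArg Prod.fst hy
    have h2 : e (e.symm σ) * p = e y := congrArg Prod.snd hy
    rw [Equiv.apply_symm_apply] at h2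
    simp only [ρ, h2, Equiv.symm_apply_apply, h1]
  have hmul : ∀ σ τ : Perm (Fin 4), ρ (σ * τ) = ρ σ * ρ τ := by
    intro σ τ
    have hτ : τ ∈ Submonoid.closure {swap (0 : Fin 4) 1, swap 1 2, swap 2 3} := by
      rw [closure_swap]; trivial
    induction hτ using Submonoid.closure_induction_right with
    | one => rw [mul_one, hone, mul_one]
    | mul_right x hx y hy ih =>
      have : ∃ s : M, (s, y) = (s₁, swap 0 1) ∨ (s, y) = (s₂, swap 1 2) ∨
          (s, y) = (s₃, swap 2 3) := by
        rcases hy with rfl | rfl | rfl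
        exacts [⟨s₁, by simp⟩, ⟨s₂, by simp⟩, ⟨s₃, by simp⟩]
      obtain ⟨s, hs⟩ := this
      rw [← mul_assoc, hgen _ s y hs, ih, hgen _ s y hs, mul_assoc]
  refine ⟨⟨⟨ρ, hone⟩, hmul⟩, ?_, ?_, ?_⟩
  · have := hgen 1 s₁ _ (.inl rfl)
    rwa [one_mul, hone, one_mul] at this
  · have := hgen 1 s₂ _ (.inr (.inl rfl))
    rwa [one_mul, hone, one_mul] at this
  · have := hgen 1 s₃ _ (.inr (.inr rfl))
    rwa [one_mul, hone, one_mul] at this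

end SymmetricFour

/-! ### Pure tensors in the summands of `H4`. -/

section Summands

open scoped TensorProduct

variable {K : Type w} [Field K] {C : Type u} [Category.{v} C] [Abelian C]
  [Linear K C] [MonoidalCategory C] {I : Type t} {S : SimpleReps C I}

theorem Tensor4.hom_ext {V₁ V₂ V₃ V₄ : Type v} {V : Type*}
    [AddCommGroup V₁] [AddCommGroup V₂] [AddCommGroup V₃] [AddCommGroup V₄] [AddCommMonoid V]
    [Module K V₁] [Module K V₂] [Module K V₃] [Module K V₄] [Module K V]
    {f g : Tensor4 K V₁ V₂ V₃ V₄ →ₗ[K] V}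
    (h : ∀ x₁ x₂ x₃ x₄, f (tmul4 K x₁ x₂ x₃ x₄) = g (tmul4 K x₁ x₂ x₃ x₄)) : f = g := by
  ext x₁ x₂ x₃ x₄
  exact h x₁ x₂ x₃ x₄

/-- A functional that does not vanish on `y` contracts the second factor and recovers `x` up to a
non-zero scalar. -/
theorem TensorProduct.tmul_left_injective_of_ne_zero {V W : Type*} [AddCommGroup V]
    [AddCommGroup W] [Module K V] [Module K W] {y : W} (hy : y ≠ 0) :
    Function.Injective fun x : V => x ⊗ₜ[K] y := by
  intro x₁ x₂ h
  obtain ⟨φ, hφ⟩ := not_forall.1 (mt (Module.forall_dual_apply_eq_zero_iff K y).1 hy)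
  have h1 := congrArg ((TensorProduct.rid K V).toLinearMap ∘ₗ φ.lTensor V) h
  simpa [hφ] using h1

theorem tmul4_left_injective {V₁ V₂ V₃ V₄ : Type v}
    [AddCommGroup V₁] [AddCommGroup V₂] [AddCommGroup V₃] [AddCommGroup V₄]
    [Module K V₁] [Module K V₂] [Module K V₃] [Module K V₄]
    {x₂ : V₂} {x₃ : V₃} {x₄ : V₄} (h₂ : x₂ ≠ 0) (h₃ : x₃ ≠ 0) (h₄ : x₄ ≠ 0) :
    Function.Injective fun x₁ : V₁ => tmul4 K x₁ x₂ x₃ x₄ :=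
  (TensorProduct.tmul_left_injective_of_ne_zero h₄).comp
    ((TensorProduct.tmul_left_injective_of_ne_zero h₃).comp
      (TensorProduct.tmul_left_injective_of_ne_zero h₂))

theorem H4.hom_ext {V : Type*} [AddCommMonoid V] [Module K V] {f g : H4 K S →ₗ[K] V}
    (hF : ∀ i j k p q l (β : S.obj j ⊗ S.obj k ⟶ S.obj p) (δ : S.obj l ⟶ S.obj q ⊗ S.obj k)
      (α : S.obj i ⊗ S.obj p ⟶ S.obj l) (γ : S.obj q ⟶ S.obj i ⊗ S.obj j),
      f (inF K S ⟨i, j, k, p, q, l⟩ (tmul4 K β δ α γ)) =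
        g (inF K S ⟨i, j, k, p, q, l⟩ (tmul4 K β δ α γ)))
    (hG : ∀ i j k p q l (β : S.obj p ⟶ S.obj j ⊗ S.obj k) (δ : S.obj q ⊗ S.obj k ⟶ S.obj l)
      (α : S.obj l ⟶ S.obj i ⊗ S.obj p) (γ : S.obj i ⊗ S.obj j ⟶ S.obj q),
      f (inG K S ⟨i, j, k, p, q, l⟩ (tmul4 K β δ α γ)) =
        g (inG K S ⟨i, j, k, p, q, l⟩ (tmul4 K β δ α γ))) :
    f = g := by
  refine DirectSum.linearMap_ext _ fun ⟨i, j, k, p, q, l⟩ => LinearMap.prod_ext ?_ ?_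
  · exact Tensor4.hom_ext (hF i j k p q l)
  · exact Tensor4.hom_ext (hG i j k p q l)

theorem inG_injective (a : Labels I) : Function.Injective (inG K S a) :=
  (DirectSum.of_injective a).comp LinearMap.inr_injective

end Summands

/-! ### The Coxeter relations for the maps τ. -/

namespace Rigidity

open MonoidalTrace

section Relations

variable {K : Type w} [Field K] {C : Type u} [Category.{v} C] [Abelian C]
  [Linear K C] [MonoidalCategory C] [MonoidalPreadditive C] [MonoidalLinear K C]
  {I : Type t} {S : SimpleReps C I} (r : Rigidity S) {i j k p q l : I}

section F

variable (β : S.obj j ⊗ S.obj k ⟶ S.obj p) (δ : S.obj l ⟶ S.obj q ⊗ S.obj k)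
  (α : S.obj i ⊗ S.obj p ⟶ S.obj l) (γ : S.obj q ⟶ S.obj i ⊗ S.obj j)

theorem tau12_inF : r.tau12 K (inF K S ⟨i, j, k, p, q, l⟩ (tmul4 K β δ α γ)) =
    inG K S ⟨r.bar i, q, k, l, j, p⟩ (tmul4 K δ β (r.partialL K _ _ _ α) (r.coPartialL K _ _ _ γ)) := by
  rw [tau12, fromSummands_inF]; rfl

theorem tau23_inF : r.tau23 K (inF K S ⟨i, j, k, p, q, l⟩ (tmul4 K β δ α γ)) =
    inG K S ⟨q, r.bar j, p, k, i, l⟩ (tmul4 K (r.partialL K _ _ _ β) α δ (r.coPartialR K _ _ _ γ)) := by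
  rw [tau23, fromSummands_inF]; rfl

theorem tau34_inF : r.tau34 K (inF K S ⟨i, j, k, p, q, l⟩ (tmul4 K β δ α γ)) =
    inG K S ⟨i, p, r.bar k, j, l, q⟩ (tmul4 K (r.partialR K _ _ _ β) (r.coPartialR K _ _ _ δ) γ α) := by
  rw [tau34, fromSummands_inF]; rfl

-- Applying τ₁₂ twice lands in the summand with label `bar (bar i)`. With a free label `m` in its
-- place the equation can be substituted, and the two dualisations then cancel as mutually inverse
-- bijections. The transport lemmas that follow do the same for the other labels.
omit [MonoidalPreadditive C] [MonoidalLinear K C] in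
theorem inF_transport_i (m : I) (h : m = i) (h₁ : r.bar m = r.bar i)
    (h₂ : r.bar (r.bar i) = m) :
    inF K S ⟨m, j, k, p, q, l⟩ (tmul4 K β δ ((lE (r.pairing h₁)).symm (lE (r.left i) α))
      (lE (r.pairing h₂) ((lE (r.right i)).symm γ))) = inF K S ⟨i, j, k, p, q, l⟩ (tmul4 K β δ α γ) := by
  subst h
  rw [Equiv.symm_apply_apply, Equiv.apply_symm_apply]

omit [MonoidalPreadditive C] [MonoidalLinear K C] in
theorem inF_transport_j (m : I) (h : m = j) (h₁ : r.bar m = r.bar j) :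
    inF K S ⟨i, m, k, p, q, l⟩ (tmul4 K ((lE (r.pairing h₁)).symm (lE (r.left j) β)) δ α
      (rE (r.pairing h₁) ((rE (r.left j)).symm γ))) = inF K S ⟨i, j, k, p, q, l⟩ (tmul4 K β δ α γ) := by
  subst h
  rw [Equiv.symm_apply_apply, Equiv.apply_symm_apply]

omit [MonoidalPreadditive C] [MonoidalLinear K C] in
theorem inF_transport_k (m : I) (h : m = k) (h₁ : r.bar m = r.bar k)
    (h₂ : r.bar (r.bar k) = m) :
    inF K S ⟨i, j, m, p, q, l⟩ (tmul4 K ((rE (r.pairing h₂)).symm (rE (r.right k) β))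
      (rE (r.pairing h₁) ((rE (r.left k)).symm δ)) α γ) = inF K S ⟨i, j, k, p, q, l⟩ (tmul4 K β δ α γ) := by
  subst h
  rw [Equiv.symm_apply_apply, Equiv.apply_symm_apply]

end F

section G

variable (β : S.obj p ⟶ S.obj j ⊗ S.obj k) (δ : S.obj q ⊗ S.obj k ⟶ S.obj l)
  (α : S.obj l ⟶ S.obj i ⊗ S.obj p) (γ : S.obj i ⊗ S.obj j ⟶ S.obj q)

theorem tau12_inG : r.tau12 K (inG K S ⟨i, j, k, p, q, l⟩ (tmul4 K β δ α γ)) =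
    inF K S ⟨r.bar i, q, k, l, j, p⟩ (tmul4 K δ β (r.coPartialL K _ _ _ α) (r.partialL K _ _ _ γ)) := by
  rw [tau12, fromSummands_inG]; rfl

theorem tau23_inG : r.tau23 K (inG K S ⟨i, j, k, p, q, l⟩ (tmul4 K β δ α γ)) =
    inF K S ⟨q, r.bar j, p, k, i, l⟩ (tmul4 K (r.coPartialL K _ _ _ β) α δ (r.partialR K _ _ _ γ)) := by
  rw [tau23, fromSummands_inG]; rfl

theorem tau34_inG : r.tau34 K (inG K S ⟨i, j, k, p, q, l⟩ (tmul4 K β δ α γ)) =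
    inF K S ⟨i, p, r.bar k, j, l, q⟩ (tmul4 K (r.coPartialR K _ _ _ β) (r.partialR K _ _ _ δ) γ α) := by
  rw [tau34, fromSummands_inG]; rfl

omit [MonoidalPreadditive C] [MonoidalLinear K C] in
theorem inG_transport_i (m : I) (h : m = i) (h₁ : r.bar m = r.bar i)
    (h₂ : r.bar (r.bar i) = m) :
    inG K S ⟨m, j, k, p, q, l⟩ (tmul4 K β δ (lE (r.pairing h₂) ((lE (r.right i)).symm α))
      ((lE (r.pairing h₁)).symm (lE (r.left i) γ))) = inG K S ⟨i, j, k, p, q, l⟩ (tmul4 K β δ α γ) := by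
  subst h
  rw [Equiv.symm_apply_apply, Equiv.apply_symm_apply]

omit [MonoidalPreadditive C] [MonoidalLinear K C] in
theorem inG_transport_j (m : I) (h : m = j) (h₂ : r.bar (r.bar j) = m) :
    inG K S ⟨i, m, k, p, q, l⟩ (tmul4 K (lE (r.pairing h₂) ((lE (r.right j)).symm β)) δ α
      ((rE (r.pairing h₂)).symm (rE (r.right j) γ))) = inG K S ⟨i, j, k, p, q, l⟩ (tmul4 K β δ α γ) := by
  subst h
  rw [Equiv.symm_apply_apply, Equiv.apply_symm_apply]

omit [MonoidalPreadditive C] [MonoidalLinear K C] in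
theorem inG_transport_k (m : I) (h : m = k) (h₁ : r.bar m = r.bar k)
    (h₂ : r.bar (r.bar k) = m) :
    inG K S ⟨i, j, m, p, q, l⟩ (tmul4 K (rE (r.pairing h₁) ((rE (r.left k)).symm β))
      ((rE (r.pairing h₂)).symm (rE (r.right k) δ)) α γ) = inG K S ⟨i, j, k, p, q, l⟩ (tmul4 K β δ α γ) := by
  subst h
  rw [Equiv.symm_apply_apply, Equiv.apply_symm_apply]

end G

theorem tau12_sq : r.tau12 K ∘ₗ r.tau12 K = (LinearMap.id : H4 K S →ₗ[K] H4 K S) := by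
  refine H4.hom_ext (fun i j k p q l β δ α γ => ?_) fun i j k p q l β δ α γ => ?_
  · rw [LinearMap.comp_apply, tau12_inF, tau12_inG]
    exact r.inF_transport_i β δ α γ _ (r.bar_bar _) (r.bar_bar _) rfl
  · rw [LinearMap.comp_apply, tau12_inG, tau12_inF]
    exact r.inG_transport_i β δ α γ _ (r.bar_bar _) (r.bar_bar _) rfl

theorem tau23_sq : r.tau23 K ∘ₗ r.tau23 K = (LinearMap.id : H4 K S →ₗ[K] H4 K S) := by
  refine H4.hom_ext (fun i j k p q l β δ α γ => ?_) fun i j k p q l β δ α γ => ?_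
  · rw [LinearMap.comp_apply, tau23_inF, tau23_inG]
    exact r.inF_transport_j β δ α γ _ (r.bar_bar _) (r.bar_bar _)
  · rw [LinearMap.comp_apply, tau23_inG, tau23_inF]
    exact r.inG_transport_j β δ α γ _ (r.bar_bar _) rfl

theorem tau34_sq : r.tau34 K ∘ₗ r.tau34 K = (LinearMap.id : H4 K S →ₗ[K] H4 K S) := by
  refine H4.hom_ext (fun i j k p q l β δ α γ => ?_) fun i j k p q l β δ α γ => ?_
  · rw [LinearMap.comp_apply, tau34_inF, tau34_inG]
    exact r.inF_transport_k β δ α γ _ (r.bar_bar _) (r.bar_bar _) rfl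
  · rw [LinearMap.comp_apply, tau34_inG, tau34_inF]
    exact r.inG_transport_k β δ α γ _ (r.bar_bar _) (r.bar_bar _) rfl

theorem tau34_comp_tau12 : r.tau34 K ∘ₗ r.tau12 K = r.tau12 K ∘ₗ (r.tau34 K (S := S)) := by
  refine H4.hom_ext (fun i j k p q l β δ α γ => ?_) fun i j k p q l β δ α γ => ?_
  · rw [LinearMap.comp_apply, LinearMap.comp_apply, tau12_inF, tau34_inG, tau34_inF, tau12_inG]
  · rw [LinearMap.comp_apply, LinearMap.comp_apply, tau12_inG, tau34_inF, tau34_inG, tau12_inF]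

section Braid

variable {r} in
theorem doubleDual_eq_self_iff (i j k : I) (α : S.obj i ⊗ S.obj j ⟶ S.obj k) :
    r.doubleDual i j k α = α ↔
      r.partialL K j (r.bar k) (r.bar i) (r.coPartialR K (r.bar i) k j (r.partialL K i j k α)) =
      r.partialR K (r.bar k) i (r.bar j) (r.coPartialL K k (r.bar j) i (r.partialR K i j k α)) :=
  tensorBidual_eq_iff (r.right i) (r.left i) (r.right j) (r.left j) (r.right k) (r.left k) α

-- The covector form of the braid identity is the identity for the partial dual `Rθ`, with one
-- dualisation moved to the other side.
variable {r} in
theorem coPartial_braid (h : ∀ (i j k : I) (α : S.obj i ⊗ S.obj j ⟶ S.obj k),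
    r.doubleDual i j k α = α) (i j k : I) (θ : S.obj k ⟶ S.obj i ⊗ S.obj j) :
    r.coPartialL K j (r.bar k) (r.bar i) (r.partialR K (r.bar i) k j (r.coPartialL K i j k θ)) =
    r.coPartialR K (r.bar k) i (r.bar j)
      (r.partialL K k (r.bar j) i (r.coPartialR K i j k θ)) := by
  -- The dual of `X_(bar j)` should be `X_j` itself and not `X_(bar (bar j))`, so the label of the
  -- dual is kept free.
  have key : ∀ (m m' : I) (h₁ : r.bar m = m') (h₂ : r.bar m' = m)
      (α : S.obj k ⊗ S.obj m ⟶ S.obj i),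
      tensorBidual (r.right k) (r.left k) (r.pairing h₂) (r.pairing h₁)
        (r.right i) (r.left i) α = α := by
    rintro m _ rfl _ α
    exact h k m i α
  have h1 := (tensorBidual_eq_iff _ _ _ _ _ _ _).1 (key (r.bar j) j (r.bar_bar j) rfl
    ((rE (r.left j)).symm θ))
  rw [Equiv.apply_symm_apply, ← Equiv.eq_symm_apply] at h1
  exact h1.symm

theorem tau12_braid (h : ∀ (i j k : I) (α : S.obj i ⊗ S.obj j ⟶ S.obj k),
    r.doubleDual i j k α = α) :
    r.tau23 K ∘ₗ r.tau12 K ∘ₗ r.tau23 K = r.tau12 K ∘ₗ r.tau23 K ∘ₗ (r.tau12 K (S := S)) := by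
  refine H4.hom_ext (fun i j k p q l β δ α γ => ?_) fun i j k p q l β δ α γ => ?_
  · simp only [LinearMap.comp_apply]
    rw [tau12_inF, tau23_inG, tau12_inF, tau23_inF, tau12_inG, tau23_inF]
    exact congrArg (fun x => inG K S ⟨r.bar j, r.bar i, l, p, r.bar q, k⟩
      (tmul4 K _ _ _ x)) (coPartial_braid h i j q γ).symm
  · simp only [LinearMap.comp_apply]
    rw [tau12_inG, tau23_inF, tau12_inG, tau23_inG, tau12_inF, tau23_inG]
    exact congrArg (fun x => inF K S ⟨r.bar j, r.bar i, l, p, r.bar q, k⟩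
      (tmul4 K _ _ _ x)) ((doubleDual_eq_self_iff i j q γ).1 (h _ _ _ γ)).symm

theorem tau34_braid (h : ∀ (i j k : I) (α : S.obj i ⊗ S.obj j ⟶ S.obj k),
    r.doubleDual i j k α = α) :
    r.tau34 K ∘ₗ r.tau23 K ∘ₗ r.tau34 K = r.tau23 K ∘ₗ r.tau34 K ∘ₗ (r.tau23 K (S := S)) := by
  refine H4.hom_ext (fun i j k p q l β δ α γ => ?_) fun i j k p q l β δ α γ => ?_
  · simp only [LinearMap.comp_apply]
    rw [tau34_inF, tau23_inG, tau34_inF, tau23_inF, tau34_inG, tau23_inF]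
    exact congrArg (fun x => inG K S ⟨l, r.bar k, r.bar j, r.bar p, q, i⟩
      (tmul4 K x _ _ _)) ((doubleDual_eq_self_iff j k p β).1 (h _ _ _ β)).symm
  · simp only [LinearMap.comp_apply]
    rw [tau34_inG, tau23_inF, tau34_inG, tau23_inG, tau34_inF, tau23_inG]
    exact congrArg (fun x => inF K S ⟨l, r.bar k, r.bar j, r.bar p, q, i⟩
      (tmul4 K x _ _ _)) (coPartial_braid h j k p β).symm

theorem relations (h : ∀ (i j k : I) (α : S.obj i ⊗ S.obj j ⟶ S.obj k),
    r.doubleDual i j k α = α) :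
    SymmetricFour.Relations (M := Module.End K (H4 K S)) (r.tau12 K) (r.tau23 K) (r.tau34 K) where
  sq₁ := r.tau12_sq
  sq₂ := r.tau23_sq
  sq₃ := r.tau34_sq
  comm := r.tau34_comp_tau12
  braid₁₂ := r.tau12_braid h
  braid₂₃ := r.tau34_braid h

end Braid

end Relations

end Rigidity

/-! ### Invariance of `𝔽`, and the converse. -/

namespace Rigidity

open MonoidalTrace

section Invariance

variable {K : Type w} [Field K] [IsAlgClosed K] {C : Type u} [Category.{v} C] [Abelian C]
  [Linear K C] [MonoidalCategory C] [MonoidalPreadditive C] [MonoidalLinear K C]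
  [FusionCategory K C] {I : Type t} {S : SimpleReps C I} {r : Rigidity S} {D : I → K}

theorem FTotal_inF (D : I → K) (i j k p q l : I) (β : S.obj j ⊗ S.obj k ⟶ S.obj p)
    (δ : S.obj l ⟶ S.obj q ⊗ S.obj k) (α : S.obj i ⊗ S.obj p ⟶ S.obj l)
    (γ : S.obj q ⟶ S.obj i ⊗ S.obj j) :
    FTotal K D (inF K S ⟨i, j, k, p, q, l⟩ (tmul4 K β δ α γ)) =
      D l * scalar K _ (δ ≫ γ ▷ S.obj k ≫ (α_ _ _ _).hom ≫ S.obj i ◁ β ≫ α) := by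
  rw [FTotal, fromSummands_inF]; rfl

theorem FTotal_inG (D : I → K) (i j k p q l : I) (β : S.obj p ⟶ S.obj j ⊗ S.obj k)
    (δ : S.obj q ⊗ S.obj k ⟶ S.obj l) (α : S.obj l ⟶ S.obj i ⊗ S.obj p)
    (γ : S.obj i ⊗ S.obj j ⟶ S.obj q) :
    FTotal K D (inG K S ⟨i, j, k, p, q, l⟩ (tmul4 K β δ α γ)) =
      D l * scalar K _ (α ≫ S.obj i ◁ β ≫ (α_ _ _ _).inv ≫ γ ▷ S.obj k ≫ δ) := by
  rw [FTotal, fromSummands_inG]; rfl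

/-- It suffices to check the invariance of `𝔽` under an involution on half of the summands. -/
theorem FTotal_comp_eq {τ : H4 K S →ₗ[K] H4 K S} (hτ : τ ∘ₗ τ = LinearMap.id)
    (hF : ∀ a x, FTotal K D (τ (inF K S a x)) = FTotal K D (inF K S a x))
    (hG : ∀ a x, ∃ b y, τ (inG K S a x) = inF K S b y) :
    FTotal K D ∘ₗ τ = FTotal K D := by
  refine DirectSum.linearMap_ext _ fun a => LinearMap.prod_ext ?_ ?_
  · exact LinearMap.ext fun x => hF a x
  · refine LinearMap.ext fun x => ?_
    obtain ⟨b, y, hy⟩ := hG a x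
    have h1 := hF b y
    rw [← hy] at h1
    have h2 : τ (τ (inG K S a x)) = inG K S a x := LinearMap.congr_fun hτ _
    rw [h2] at h1
    exact h1.symm

theorem FTotal_tau12 (hr : r.EqualDims K) (hD : r.IsRoot K D)
    (h : ∀ (i j k : I) (α : S.obj i ⊗ S.obj j ⟶ S.obj k), r.doubleDual i j k α = α) :
    FTotal K D ∘ₗ r.tau12 K = FTotal K D := by
  refine FTotal_comp_eq r.tau12_sq (fun a x => ?_) fun a x =>
    ⟨_, r.tau12G K a x, fromSummands_inG _ _ _ _⟩
  obtain ⟨i, j, k, p, q, l⟩ := a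
  change (FTotal K D ∘ₗ r.tau12 K ∘ₗ inF K S _) x = (FTotal K D ∘ₗ inF K S _) x
  refine LinearMap.congr_fun (Tensor4.hom_ext fun β δ α γ => ?_) x
  simp only [LinearMap.comp_apply]
  rw [tau12_inF, FTotal_inG, FTotal_inF, hD.coherent _ (hr p), hD.coherent _ (hr l), hr p, hr l]
  -- The closed diagram is cut at `p` instead of `l`; this exchanges the factors `D l` and `D p`.
  have h1 := r.scalar_comp_mul_dimR (K := K) i p l α
    (δ ≫ γ ▷ S.obj k ≫ (α_ _ _ _).hom ≫ S.obj i ◁ β)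
  have h2 : r.coPartialL K i p l (δ ≫ γ ▷ S.obj k ≫ (α_ _ _ _).hom ≫ S.obj i ◁ β) =
      _ ◁ δ ≫ (α_ _ _ _).inv ≫ r.coPartialL K i j q γ ▷ S.obj k ≫ β :=
    lE_symm_comp (r.right i) δ γ β
  rw [h, h2] at h1
  simp only [Category.assoc] at h1
  rw [mul_comm, ← h1, mul_comm]

theorem FTotal_tau23 (D : I → K) :
    FTotal K D ∘ₗ r.tau23 K = FTotal K D := by
  refine FTotal_comp_eq r.tau23_sq (fun a x => ?_) fun a x =>
    ⟨_, r.tau23G K a x, fromSummands_inG _ _ _ _⟩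
  obtain ⟨i, j, k, p, q, l⟩ := a
  change (FTotal K D ∘ₗ r.tau23 K ∘ₗ inF K S _) x = (FTotal K D ∘ₗ inF K S _) x
  refine LinearMap.congr_fun (Tensor4.hom_ext fun β δ α γ => ?_) x
  simp only [LinearMap.comp_apply]
  rw [tau23_inF, FTotal_inG, FTotal_inF]
  have h1 : S.obj q ◁ r.partialL K j k p β ≫ (α_ _ _ _).inv ≫ r.coPartialR K i j q γ ▷ S.obj p =
      γ ▷ S.obj k ≫ (α_ _ _ _).hom ≫ S.obj i ◁ β :=
    whiskerLeft_lE_comp_rE_symm (r.left j) γ β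
  rw [reassoc_of% h1]

theorem FTotal_tau34 (hr : r.EqualDims K) (hD : r.IsRoot K D)
    (h : ∀ (i j k : I) (α : S.obj i ⊗ S.obj j ⟶ S.obj k), r.doubleDual i j k α = α) :
    FTotal K D ∘ₗ r.tau34 K = FTotal K D := by
  refine FTotal_comp_eq r.tau34_sq (fun a x => ?_) fun a x =>
    ⟨_, r.tau34G K a x, fromSummands_inG _ _ _ _⟩
  obtain ⟨i, j, k, p, q, l⟩ := a
  change (FTotal K D ∘ₗ r.tau34 K ∘ₗ inF K S _) x = (FTotal K D ∘ₗ inF K S _) x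
  refine LinearMap.congr_fun (Tensor4.hom_ext fun β δ α γ => ?_) x
  simp only [LinearMap.comp_apply]
  rw [tau34_inF, FTotal_inG, FTotal_inF, hD.coherent _ (hr q), hD.coherent _ (hr l)]
  have h1 := r.scalar_comp_mul_dimL (K := K) q k l
    (γ ▷ S.obj k ≫ (α_ _ _ _).hom ≫ S.obj i ◁ β ≫ α) δ
  have h2 : r.partialR K q k l (γ ▷ S.obj k ≫ (α_ _ _ _).hom ≫ S.obj i ◁ β ≫ α) =
      γ ≫ S.obj i ◁ r.partialR K j k p β ≫ (α_ _ _ _).inv ≫ α ▷ _ :=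
    rE_comp (r.right k) γ β α
  rw [h, h2] at h1
  simp only [Category.assoc] at h1
  rw [mul_comm, ← h1, mul_comm]

theorem tetrahedralSymmetry_of_doubleDual (hr : r.EqualDims K) (hD : r.IsRoot K D)
    (h : ∀ (i j k : I) (α : S.obj i ⊗ S.obj j ⟶ S.obj k), r.doubleDual i j k α = α) :
    r.TetrahedralSymmetry K D := by
  obtain ⟨ρ, h12, h23, h34⟩ := SymmetricFour.exists_monoidHom (r.relations (K := K) h)
  refine ⟨ρ, h12, h23, h34, fun σ x => ?_⟩
  have key : ∀ σ : Equiv.Perm (Fin 4), FTotal K D ∘ₗ ρ σ = FTotal K D := by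
    intro σ
    have hσ : σ ∈ Submonoid.closure
        {Equiv.swap (0 : Fin 4) 1, Equiv.swap 1 2, Equiv.swap 2 3} := by
      rw [SymmetricFour.closure_swap]; trivial
    induction hσ using Submonoid.closure_induction with
    | one => rw [map_one]; rfl
    | mem y hy =>
      rcases hy with rfl | rfl | rfl
      · rw [h12]; exact FTotal_tau12 hr hD h
      · rw [h23]; exact FTotal_tau23 D
      · rw [h34]; exact FTotal_tau34 hr hD h
    | mul y z _ _ hy hz =>
      rw [map_mul, Module.End.mul_eq_comp, ← LinearMap.comp_assoc, hy, hz]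
  exact LinearMap.congr_fun (key σ⁻¹) x

omit [IsAlgClosed K] [FusionCategory K C] in
theorem partialR_ne_zero {i j k : I} {f : S.obj i ⊗ S.obj j ⟶ S.obj k} (hf : f ≠ 0) :
    r.partialR K i j k f ≠ 0 := fun h =>
  hf ((rE (r.right j)).injective (h.trans (map_zero (r.partialR K i j k)).symm))

omit [IsAlgClosed K] [FusionCategory K C] in
theorem coPartialR_ne_zero {i j k : I} {f : S.obj k ⟶ S.obj i ⊗ S.obj j} (hf : f ≠ 0) :
    r.coPartialR K i j k f ≠ 0 := fun h =>
  hf ((rE (r.left j)).symm.injective (h.trans (map_zero (r.coPartialR K i j k)).symm))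

theorem doubleDual_of_tetrahedralSymmetry (h : r.TetrahedralSymmetry K D) (i j k : I)
    (α : S.obj i ⊗ S.obj j ⟶ S.obj k) : r.doubleDual i j k α = α := by
  by_cases hα : α = 0
  · subst hα
    exact map_zero (r.doubleDualLinear (K := K) i j k)
  obtain ⟨ρ, -, h23, h34, -⟩ := h
  have hb : r.tau34 K ∘ₗ r.tau23 K ∘ₗ r.tau34 K =
      r.tau23 K ∘ₗ r.tau34 K ∘ₗ (r.tau23 K (S := S)) := by
    rw [← h23, ← h34]
    simp only [← Module.End.mul_eq_comp, ← map_mul]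
    congr 1
    decide
  -- To place an arbitrary `α` in the first factor, the remaining factors must be non-zero with
  -- matching labels: unit constraints serve for two of them and a section of `α` for the third.
  obtain ⟨e, ⟨u⟩⟩ := S.exists_iso (𝟙_ C) (FusionCategory.simple_unit K)
  have hiso : ∀ (x : C) (m : I) (f : x ≅ S.obj m), f.hom ≠ 0 ∧ f.inv ≠ 0 := fun x m f =>
    ⟨fun h0 => id_nonzero (S.obj m) (by rw [← f.inv_hom_id, h0, comp_zero]),
      fun h0 => id_nonzero (S.obj m) (by rw [← f.inv_hom_id, h0, zero_comp])⟩
  let unitor (m : I) : S.obj e ⊗ S.obj m ≅ S.obj m := whiskerRightIso u.symm _ ≪≫ λ_ _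
  obtain ⟨δ, hδ⟩ := exists_section K hα
  have hδ0 : δ ≠ 0 := by
    rintro rfl
    rw [zero_comp] at hδ
    exact id_nonzero _ hδ.symm
  have h1 := LinearMap.congr_fun hb
    (inF K S ⟨e, i, j, k, i, k⟩ (tmul4 K α δ (unitor k).hom (unitor i).inv))
  simp only [LinearMap.comp_apply] at h1
  rw [tau34_inF, tau23_inG, tau34_inF, tau23_inF, tau34_inG, tau23_inF] at h1
  exact (doubleDual_eq_self_iff i j k α).2 (tmul4_left_injective
    (coPartialR_ne_zero (hiso _ _ (unitor i)).2) (partialR_ne_zero (hiso _ _ (unitor k)).1)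
    (coPartialR_ne_zero hδ0) (inG_injective _ h1)).symm

end Invariance

end Rigidity

end

theorem corollary4p7 {K : Type w} [Field K] [IsAlgClosed K] [CharZero K]
    {C : Type u} [Category.{v} C] [Abelian C] [Linear K C] [MonoidalCategory C]
    [MonoidalPreadditive C] [MonoidalLinear K C] [FusionCategory K C]
    {I : Type t} [Finite I] (S : SimpleReps C I) :
    (∃ r : Rigidity S, r.EqualDims K) ∧
    ∀ r : Rigidity S, r.EqualDims K → ∀ D : I → K, r.IsRoot K D →
      (∀ i j k : I, ∃ (n : ℕ) (b : Module.Basis (Fin n) K (S.obj i ⊗ S.obj j ⟶ S.obj k)),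
        r.IsEigenbasis D i j k b) ∧
      (r.TetrahedralSymmetry K D ↔
        ∀ (i j k : I) (ε : K) (α : S.obj i ⊗ S.obj j ⟶ S.obj k),
          r.HasSign D i j k ε α → ε = 1) := by
  refine ⟨Rigidity.exists_equalDims K, fun r hr D hD =>
    ⟨Rigidity.exists_isEigenbasis hr hD, ?_⟩⟩
  rw [Rigidity.signs_eq_one_iff hr hD]
  exact ⟨Rigidity.doubleDual_of_tetrahedralSymmetry,
    Rigidity.tetrahedralSymmetry_of_doubleDual hr hD⟩
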